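/- \textbf{Meijer functions.} For real parameters and $z>0$ let $$G^{m,n}_{p,q}\!\left[z\,\middle|\,{a_1,\dots,a_p\atop b_1,\dots,b_q}\right]=\frac1{2\pi i}\int_{\sigma-i\infty}^{\sigma+i\infty}\frac{\prod_{j\le m}\Gamma(b_j+s)\prod_{j\le n}\Gamma(1-a_j-s)}{\prod_{m<j\le q}\Gamma(1-b_j-s)\prod_{n<j\le p}\Gamma(a_j+s)}\,z^{-s}\,ds,$$ the line $\operatorname{Re}s=\sigma$ separating the poles of the $\Gamma(b_j+s)$, $j\le m$, from those of the $\Gamma(1-a_j-s)$, $j\le n$. \textbf{Radio link.} Let $L\ge1$ and $p\ge1$ be integers, $\mu,\kappa,\alpha,D,\varrho>0$, $C=\frac1{72}(735,-1190,455)$, $\beta=(2,4,6)$, $\Psi_i=(\beta_i+1)/\alpha$ for $i=1,2,3$, $c_k=L\mu+k$ and $$V_k=\frac{\Gamma(p+k)\,p^{1-2k}}{\Gamma(k+1)\Gamma(p-k+1)\Gamma(L\mu+k)},\qquad K_{1,i,k}=\frac{C_iV_k(L\mu\kappa)^k}{\alpha e^{L\mu\kappa}},\qquad K_2=\frac{\mu(1+\kappa)D^\alpha}{\varrho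 L\bar\gamma_R},$$ where $\bar\gamma_R>0$ is the average SNR. The received SNR is modelled by the density $$f_R(\gamma)=\sum_{i=1}^3\sum_{k=0}^pK_{1,i,k}\,\gamma^{-1}\,G^{1,1}_{1,2}\!\left[K_2\gamma\,\middle|\,{1-\Psi_i\atop c_k,-\Psi_i}\right]\quad(\gamma>0),\qquad F_R(x)=\int_0^xf_R.$$ \textbf{Optical links.} For $n\in\{\mathcal D,\tilde{\mathcal E}\}$ (destination, eavesdropper) let $r_n\in\{1,2\}$, let $\mathcal N_n\ge1$ be an integer, let $E_n>0$ and $v_n>0$ be the mean and variance of a square-integrable channel coefficient $Y_n$ with an arbitrary law, and put $\rho_n=(\mathcal N_nE_n)^2/(\mathcal N_nv_n)$, $w_n=v_n/E_n$. At electrical SNR $\tau_n>0$ put $$\Upsilon_{1n}=\frac{E_n^{\rho_n}}{r_n\Gamma(\rho_n)w_n^{\rho_n}\tau_n^{\rho_n/r_n}},\quad\Upsilon_{2n}=\frac{E_n}{w_n\tau_n^{1/r_n}},\quad\Upsilon_{3n}=\frac{\sqrt{r_n}\,\Upsilon_{1n}}{(2\pi)^{(r_n-1)/2}},\quad\Upsilon_{4n}=\frac{E_n^{r_n}}{r_n^{r_n}w_n^{r_n}\tau_n}.$$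 The received SNR is modelled by the density $$f_n(\gamma)=\Upsilon_{1n}\gamma^{\rho_n/r_n-1}\,G^{1,0}_{0,1}\!\left[\Upsilon_{2n}\gamma^{1/r_n}\,\middle|\,{-\atop0}\right]\quad(\gamma>0),\qquad F_n(x)=\int_0^xf_n.$$ \textbf{Outage.} Let $\mathcal R_s>0$, $\phi=2^{\mathcal R_s}$. The Scenario II lower bound of the secrecy outage probability is $$SOP_L^{II}=\bigl(1-F_R(\phi-1)\bigr)\int_0^\infty F_{\mathcal D}(\phi\gamma)f_{\tilde{\mathcal E}}(\gamma)\,d\gamma+F_R(\phi-1).$$ Put $\zeta=\frac{\rho_{\mathcal D}}{r_{\mathcal D}}+\frac{\rho_{\tilde{\mathcal E}}}{r_{\tilde{\mathcal E}}}$, $\Upsilon_3'=\phi^{\rho_{\mathcal D}/r_{\mathcal D}}\Upsilon_{3\mathcal D}$, $\Upsilon_4'=\phi\Upsilon_{4\mathcal D}$, $\Omega_{18}=\Upsilon_{2\tilde{\mathcal E}}^{r_{\tilde{\mathcal E}}}r_{\tilde{\mathcal E}}^{-r_{\tilde{\mathcal E}}}/\Upsilon_4'$, $\Omega_{20}=K_2(\phi-1)$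 and $$T_4=\Bigl(1-\zeta-\tfrac{k}{r_{\mathcal D}}\ (0\le k<r_{\mathcal D}),\ 1-\tfrac{\rho_{\tilde{\mathcal E}}}{r_{\tilde{\mathcal E}}}\Bigr),\qquad T_5=\Bigl(\tfrac{l}{r_{\tilde{\mathcal E}}}\ (0\le l<r_{\tilde{\mathcal E}}),\ -\tfrac{\rho_{\tilde{\mathcal E}}}{r_{\tilde{\mathcal E}}}\Bigr),$$ with entries numbered from $1$. Further let $$A=\Upsilon_3'\,\Upsilon_{1\tilde{\mathcal E}}\,\frac{r_{\tilde{\mathcal E}}^{1/2}(\Upsilon_4')^{-\zeta}}{(2\pi)^{(r_{\tilde{\mathcal E}}-1)/2}},\quad G(z)=G^{r_{\tilde{\mathcal E}}+1,\,r_{\mathcal D}}_{r_{\mathcal D}+1,\,r_{\tilde{\mathcal E}}+1}\!\left[z\,\middle|\,{T_4\atop T_5}\right],\quad G_{i,k}(z)=G^{1,2}_{2,3}\!\left[z\,\middle|\,{1-\Psi_i,1\atop c_k,0,-\Psi_i}\right],$$ $$S(z)=\sum_{k=1}^{r_{\mathcal D}}z^{T_{4,k}-1}\,\frac{\prod_{l\le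 r_{\mathcal D},\,l\ne k}\Gamma(T_{4,k}-T_{4,l})\ \prod_{l=1}^{r_{\tilde{\mathcal E}}+1}\Gamma(1+T_{5,l}-T_{4,k})}{\Gamma(1+T_{4,r_{\mathcal D}+1}-T_{4,k})},\quad S_{i,k}(z)=z^{c_k}\,\frac{\Gamma(\Psi_i+c_k)\Gamma(c_k)}{\Gamma(1+c_k)\Gamma(1+\Psi_i+c_k)}.$$ \textbf{Claim.} (a) For all $\bar\gamma_R,\tau_{\mathcal D},\tau_{\tilde{\mathcal E}}>0$, $$SOP_L^{II}=A\,G(\Omega_{18})\Bigl(1-\sum_{i=1}^3\sum_{k=0}^pK_{1,i,k}G_{i,k}(\Omega_{20})\Bigr)+\sum_{i=1}^3\sum_{k=0}^pK_{1,i,k}G_{i,k}(\Omega_{20}).$$ (b) As $z\to\infty$, $G(z)-S(z)=o(z^{T_{4,k}-1})$ for every $k\le r_{\mathcal D}$. (c) As $z\to0^+$, $G_{i,k}(z)\sim S_{i,k}(z)$ for all $i=1,2,3$ and $k\ge0$. (d) Let $$SOP^{II}_\infty=A\,S(\Omega_{18})\Bigl(1-\sum_{i=1}^3\sum_{k=0}^pK_{1,i,k}S_{i,k}(\Omega_{20})\Bigr)+\sum_{i=1}^3\sum_{k=0}^pK_{1,i,k}S_{i,k}(\Omega_{20}).$$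 At high SNR, i.e. as $\bar\gamma_R\to\infty$ and $\tau_{\mathcal D}\to\infty$ (jointly, at any relative rates) with all other parameters fixed, $SOP_L^{II}\sim SOP^{II}_\infty$, i.e. their ratio tends to $1$. -/

import Mathlib

open Filter Asymptotics MeasureTheory Set
open scoped Topology

noncomputable section

namespace Secrecy

/-! ### The Meijer G-function -/

/-- The Mellin transform of the Meijer G-function with upper parameters `an ++ ap`
and lower parameters `bm ++ bq`:
`∏ Γ(b + s) ∏ Γ(1 - a - s) / (∏ Γ(1 - b' - s) ∏ Γ(a' + s))`, with `b ∈ bm`, `a ∈ an`,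
`b' ∈ bq`, `a' ∈ ap`. At a pole of a denominator factor both `1 / Γ` and the Lean quotient are
zero. -/
def meijerKernel (an ap bm bq : List ℝ) (s : ℂ) : ℂ :=
  ((bm.map fun b : ℝ => Complex.Gamma ((b : ℂ) + s)).prod *
      (an.map fun a : ℝ => Complex.Gamma (1 - (a : ℂ) - s)).prod) /
    ((bq.map fun b : ℝ => Complex.Gamma (1 - (b : ℂ) - s)).prod *
      (ap.map fun a : ℝ => Complex.Gamma ((a : ℂ) + s)).prod)

/-- The vertical line `Re s = σ` separates the poles of the factors `Γ(b + s)` from those of the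
factors `Γ(1 - a - s)`. -/
def SeparatesPoles (an bm : List ℝ) (σ : ℝ) : Prop :=
  (∀ b ∈ bm, -b < σ) ∧ ∀ a ∈ an, σ < 1 - a

open Classical in
/-- An abscissa of a vertical line that separates the two families of poles, if there is one. -/
def meijerAbscissa (an bm : List ℝ) : ℝ :=
  if h : ∃ σ, SeparatesPoles an bm σ then h.choose else 0

/-- The Meijer G-function `G^{m,n}_{p,q}[z | an, ap ; bm, bq]` with real parameters, at `z > 0`,
where `m, n` are the lengths of `bm, an` and `p, q` those of `an ++ ap, bm ++ bq`, as the
Mellin-Barnes integral `(1 / 2πi) ∫ kernel(s) z ^ (-s) ds` along a vertical line that separates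
the poles (for `2 (m + n) > p + q`, the only case used, the integral converges absolutely and does
not depend on the line). Its value is real for real parameters. -/
def meijerG (an ap bm bq : List ℝ) (z : ℝ) : ℝ :=
  (mellinInv (meijerAbscissa an bm) (meijerKernel an ap bm bq) z).re

/-! ### The radio-frequency link -/

/-- The fixed parameters of the radio-frequency link from the moving source to a receiver. -/
structure RFLink where
  /-- number of receive antennas -/
  L : ℕ
  /-- fading parameter -/
  μ : ℝ
  /-- fading parameter -/
  κ : ℝ
  /-- path-loss exponent -/
  α : ℝ
  /-- radius of the random-waypoint ball -/
  D : ℝ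
  /-- gain factor -/
  ϱ : ℝ
  L_pos : 1 ≤ L
  μ_pos : 0 < μ
  κ_pos : 0 < κ
  α_pos : 0 < α
  D_pos : 0 < D
  ϱ_pos : 0 < ϱ

/-- The coefficients `C_i` of the random-waypoint distance density. -/
def rwpC : Fin 3 → ℝ := ![735 / 72, -1190 / 72, 455 / 72]

/-- The exponents `β_i` of the random-waypoint distance density. -/
def rwpβ : Fin 3 → ℝ := ![2, 4, 6]

/-- The coefficients `V(k, p, v)` of the polynomial approximation of the Bessel function `I_v`. -/
def besselV (k p : ℕ) (v : ℝ) : ℝ :=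
  Real.Gamma (p + k) * (p : ℝ) ^ (1 - 2 * (k : ℤ)) /
    (Real.Gamma (k + 1) * Real.Gamma ((p : ℝ) - k + 1) * Real.Gamma (v + k + 1))

namespace RFLink

variable (R : RFLink)

/-- `Ψ_i` -/
def Ψ (i : Fin 3) : ℝ := (rwpβ i + 1) / R.α

/-- The exponent `L μ + k`. -/
def c (k : ℕ) : ℝ := R.L * R.μ + k

/-- `B` -/
def B : ℝ := R.μ * (1 + R.κ)

/-- `K₁`, for truncation order `p` -/
def K₁ (p : ℕ) (i : Fin 3) (k : ℕ) : ℝ :=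
  1 / (R.α * Real.exp (R.L * R.μ * R.κ)) * rwpC i * besselV k p (R.L * R.μ - 1) *
    (R.L * R.μ * R.κ) ^ k

/-- `K₂`, at average SNR `snr` -/
def K₂ (snr : ℝ) : ℝ := R.B * R.D ^ R.α / (R.ϱ * R.L * snr)

/-- The density of the received SNR. -/
def pdf (p : ℕ) (snr γ : ℝ) : ℝ :=
  ∑ i : Fin 3, ∑ k ∈ Finset.range (p + 1),
    R.K₁ p i k * γ⁻¹ * meijerG [1 - R.Ψ i] [] [R.c k] [-R.Ψ i] (R.K₂ snr * γ)

/-- The distribution function of the received SNR. -/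
def cdf (p : ℕ) (snr γ : ℝ) : ℝ := ∫ u in (0 : ℝ)..γ, R.pdf p snr u

/-- The Meijer G-function `G^{1,2}_{2,3}` in the closed form of the distribution function. -/
def G (i : Fin 3) (k : ℕ) (z : ℝ) : ℝ :=
  meijerG [1 - R.Ψ i, 1] [] [R.c k] [0, -R.Ψ i] z

/-- `z ^ (L μ + k)` times the Gamma-function quotient that replaces `G^{1,2}_{2,3}[z]` for
small `z`. -/
def residue (i : Fin 3) (k : ℕ) (z : ℝ) : ℝ :=
  z ^ R.c k * (Real.Gamma (R.Ψ i + R.c k) * Real.Gamma (0 + R.c k)) /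
    (Real.Gamma (1 + R.c k) * Real.Gamma (1 + R.Ψ i + R.c k))

end RFLink

/-! ### The underwater optical links -/

/-- The fixed parameters of an underwater optical link via the reflecting surface. -/
structure OpticalLink where
  /-- law of the channel coefficient `Y_u` of one reflecting element -/
  law : Measure ℝ
  /-- number of reflecting elements -/
  N : ℕ
  /-- detection method: `1` heterodyne, `2` intensity modulation with direct detection -/
  r : ℕ
  isProbabilityMeasure_law : IsProbabilityMeasure law
  memLp_law : MemLp (fun y : ℝ => y) 2 law
  mean_pos : 0 < ∫ y, y ∂law
  variance_pos : 0 < ProbabilityTheory.variance (fun y : ℝ => y) law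
  N_pos : 1 ≤ N
  r_eq : r = 1 ∨ r = 2

namespace OpticalLink

variable (X : OpticalLink)

/-- `E(Y_u)` -/
def meanY : ℝ := ∫ y, y ∂X.law

/-- `Var(Y_u)` -/
def varY : ℝ := ProbabilityTheory.variance (fun y : ℝ => y) X.law

/-- Shape `ρ = E(χ)² / Var(χ)`, where `χ` is the sum of `N` independent copies of `Y_u`. -/
def ρ : ℝ := (X.N * X.meanY) ^ 2 / (X.N * X.varY)

/-- Scale `w = Var(χ) / E(χ)`. -/
def w : ℝ := (X.N * X.varY) / (X.N * X.meanY)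

/-- `Υ₁`, at electrical SNR `τ` -/
def Υ₁ (τ : ℝ) : ℝ :=
  X.meanY ^ X.ρ / (X.r * Real.Gamma X.ρ * X.w ^ X.ρ * τ ^ (X.ρ / X.r))

/-- `Υ₂`, at electrical SNR `τ` -/
def Υ₂ (τ : ℝ) : ℝ := X.meanY / (X.w * τ ^ (1 / (X.r : ℝ)))

/-- `Υ₃`, at electrical SNR `τ` -/
def Υ₃ (τ : ℝ) : ℝ :=
  X.meanY ^ X.ρ /
    (√(X.r : ℝ) * Real.Gamma X.ρ * X.w ^ X.ρ * τ ^ (X.ρ / X.r) *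
      (2 * Real.pi) ^ (((X.r : ℝ) - 1) / 2))

/-- `Υ₄`, at electrical SNR `τ` -/
def Υ₄ (τ : ℝ) : ℝ := X.meanY ^ X.r / ((X.r : ℝ) ^ X.r * X.w ^ X.r * τ)

/-- The density of the received SNR, at electrical SNR `τ`. -/
def pdf (τ γ : ℝ) : ℝ :=
  X.Υ₁ τ * γ ^ (X.ρ / X.r - 1) * meijerG [] [] [0] [] (X.Υ₂ τ * γ ^ (1 / (X.r : ℝ)))

/-- The distribution function of the received SNR, at electrical SNR `τ`. -/
def cdf (τ γ : ℝ) : ℝ := ∫ u in (0 : ℝ)..γ, X.pdf τ u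

end OpticalLink

/-! ### Secrecy outage when the optical link is overheard

`R` is the radio-frequency link to the relay, `X` the optical link to the destination and `E` the
optical link to the eavesdropper; `φ = 2 ^ Rs`. -/

/-- The lower bound of the secrecy outage probability, at average radio-frequency SNR `snr` and
electrical SNRs `τX`, `τE`. -/
def sopL (R : RFLink) (X E : OpticalLink) (p : ℕ) (φ τE snr τX : ℝ) : ℝ :=
  (∫ γ in Ioi (0 : ℝ), X.cdf τX (φ * γ) * E.pdf τE γ) * (1 - R.cdf p snr (φ - 1)) +
    R.cdf p snr (φ - 1)

/-- `ζ` -/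
def ζ (X E : OpticalLink) : ℝ := X.ρ / X.r + E.ρ / E.r

/-- The `r_X + 1` upper parameters `1 - ζ - k / r_X` (`k < r_X`) and `1 - ρ_E / r_E`. -/
def T₄ (X E : OpticalLink) (k : ℕ) : ℝ :=
  if k < X.r then 1 - ζ X E - k / X.r else 1 - E.ρ / E.r

/-- The `r_E + 1` lower parameters `l / r_E` (`l < r_E`) and `-ρ_E / r_E`. -/
def T₅ (E : OpticalLink) (l : ℕ) : ℝ :=
  if l < E.r then l / E.r else -(E.ρ / E.r)

/-- The Meijer G-function `G^{r_E+1, r_X}_{r_X+1, r_E+1}` in the closed form of `sopL`. -/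
def opticalG (X E : OpticalLink) (z : ℝ) : ℝ :=
  meijerG ((List.range X.r).map (T₄ X E)) [T₄ X E X.r] ((List.range (E.r + 1)).map (T₅ E)) [] z

/-- The finite residue sum that replaces `opticalG` for large `z`. -/
def opticalResidueSum (X E : OpticalLink) (z : ℝ) : ℝ :=
  ∑ k ∈ Finset.range X.r, z ^ (T₄ X E k - 1) *
    ((∏ l ∈ (Finset.range X.r).erase k, Real.Gamma (T₄ X E k - T₄ X E l)) *
        ∏ l ∈ Finset.range (E.r + 1), Real.Gamma (1 + T₅ E l - T₄ X E k)) /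
      Real.Gamma (1 + T₄ X E X.r - T₄ X E k)

/-- `Υ₃'` -/
def Υ₃' (X : OpticalLink) (φ τX : ℝ) : ℝ := φ ^ (X.ρ / X.r) * X.Υ₃ τX

/-- `Υ₄'` -/
def Υ₄' (X : OpticalLink) (φ τX : ℝ) : ℝ := φ * X.Υ₄ τX

/-- The factor in front of `opticalG` and of its residue sum. -/
def opticalFactor (X E : OpticalLink) (φ τE τX : ℝ) : ℝ :=
  Υ₃' X φ τX * E.Υ₁ τE * (√(E.r : ℝ) * Υ₄' X φ τX ^ (-ζ X E)) /
    (2 * Real.pi) ^ (((E.r : ℝ) - 1) / 2)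

/-- `Ω₁₈`, the argument of `opticalG` -/
def Ω₁₈ (X E : OpticalLink) (φ τE τX : ℝ) : ℝ :=
  E.Υ₂ τE ^ E.r * ((E.r : ℝ) ^ E.r)⁻¹ / Υ₄' X φ τX

/-- `Ω₂₀`, the argument of the Meijer G-functions of the radio-frequency link -/
def Ω₂₀ (R : RFLink) (φ snr : ℝ) : ℝ := R.K₂ snr * (φ - 1)

/-- The closed form of `sopL` in terms of Meijer G-functions. -/
def sopMeijer (R : RFLink) (X E : OpticalLink) (p : ℕ) (φ τE snr τX : ℝ) : ℝ :=
  opticalFactor X E φ τE τX * opticalG X E (Ω₁₈ X E φ τE τX) *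
      (1 - ∑ i : Fin 3, ∑ k ∈ Finset.range (p + 1), R.K₁ p i k * R.G i k (Ω₂₀ R φ snr)) +
    ∑ i : Fin 3, ∑ k ∈ Finset.range (p + 1), R.K₁ p i k * R.G i k (Ω₂₀ R φ snr)

/-- The asymptotic expression: every Meijer G-function is replaced by its residues. -/
def sopAsymptotic (R : RFLink) (X E : OpticalLink) (p : ℕ) (φ τE snr τX : ℝ) : ℝ :=
  opticalFactor X E φ τE τX * opticalResidueSum X E (Ω₁₈ X E φ τE τX) *
      (1 - ∑ i : Fin 3, ∑ k ∈ Finset.range (p + 1), R.K₁ p i k * R.residue i k (Ω₂₀ R φ snr)) +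
    ∑ i : Fin 3, ∑ k ∈ Finset.range (p + 1), R.K₁ p i k * R.residue i k (Ω₂₀ R φ snr)

end Secrecy

end

/-! Each Meijer function here is identified with an explicit integral of elementary functions. If an
elementary `f` has the G-kernel as Mellin transform throughout the strip separating the poles, and
the kernel decays like the inverse square on vertical lines there, then Mellin inversion gives
`meijerG = f` on `z > 0`, whichever separating line was chosen (`meijerG_eq`). The decay needs no
Stirling formula, only the functional equation of Γ.

Two dictionaries produce the functions `f`. A quotient Γ(Ψ - s)/Γ(1 + Ψ - s) = 1/(Ψ - s) corresponds
to one integration with a power weight (`hasMellin_weightedPrimitive`), and a product of kernels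
corresponds to a multiplicative convolution (`hasMellin_mulConvolution`). On the radio link, the
density and the distribution function are therefore one and two integrations of `t ^ c * exp (-t)`.
On the optical links, the product of Γ(s + l/r) over l < r is the transform of a multiple of `exp
(-r t ^ (1/r))`, by the duplication formula when r = 2. The outage integral is a convolution of this
function with a reflected primitive of another of the same kind, which is `opticalG`. This yields
the closed form.

The asymptotics come from real analysis instead of moving contours: the exponential is bracketed by
its Taylor polynomial with an explicit remainder, and the bound is integrated termwise. The
coefficients so obtained are the residues, by values of Γ.

At high SNR the radio argument tends to 0+ and the optical one to infinity. The radio sum and the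
optical residue sum have positive leading coefficients, so both summands of the asymptotic
expression are eventually nonnegative. Their equivalences can then be added without cancellation,
whatever the relative rates. -/

noncomputable section

namespace Secrecy

/-! ### Mellin transforms -/

/-- The Mellin transform of the multiplicative convolution of two functions is the product of
their Mellin transforms. -/
theorem hasMellin_mulConvolution {f g : ℝ → ℂ} {s : ℂ} {m n : ℂ} (hfm : Measurable f)
    (hgm : Measurable g) (hf : HasMellin f s m) (hg : HasMellin g s n) :
    HasMellin (fun z : ℝ => ∫ t in Ioi (0 : ℝ), f t * g (z / t) / t) s (m * n) := by
  obtain ⟨hf, rfl⟩ := hf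
  obtain ⟨hg, rfl⟩ := hg
  set F : ℝ → ℂ := fun t => (t : ℂ) ^ (s - 1) * f t with hF
  set K : ℝ → ℂ := fun t => (t : ℂ) ^ (s - 1) * g t with hK
  have hFi : Integrable F (volume.restrict (Ioi 0)) := hf
  have hKi : IntegrableOn K (Ioi 0) := hg
  have hKm : Measurable K := by fun_prop
  have hFm : Measurable F := by fun_prop
  -- Since z^(s-1) = t^(s-1) (z/t)^(s-1), this is the double integrand of the transform. Each
  -- section in z is a dilate of `K`, and the factor t⁻¹ cancels its Jacobian.
  set H : ℝ × ℝ → ℂ := fun x => F x.1 * (K (x.2 * x.1⁻¹) * (x.1 : ℂ)⁻¹) with hH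
  have hHm : Measurable H := by fun_prop
  have hsec : ∀ t : ℝ, 0 < t → IntegrableOn (fun z => K (z * t⁻¹)) (Ioi 0) := by
    intro t ht
    have := (integrableOn_Ioi_comp_mul_right_iff K 0 (inv_pos.2 ht)).2 (by simpa using hKi)
    exact this
  have hsecI : ∀ {E' : Type} [NormedAddCommGroup E'] [NormedSpace ℝ E'] (k : ℝ → E') (t : ℝ), 0 < t →
      ∫ z in Ioi (0 : ℝ), k (z * t⁻¹) = t • ∫ z in Ioi (0 : ℝ), k z := by
    intro E' _ _ k t ht
    have := integral_comp_mul_right_Ioi k 0 (inv_pos.2 ht)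
    simpa using this
  have hint : Integrable H ((volume.restrict (Ioi 0)).prod (volume.restrict (Ioi 0))) := by
    rw [integrable_prod_iff hHm.aestronglyMeasurable]
    constructor
    · filter_upwards [ae_restrict_mem measurableSet_Ioi] with t ht
      have h := ((hsec t ht).mul_const (t : ℂ)⁻¹).const_mul (F t)
      exact h
    · have : ∀ᵐ t ∂(volume.restrict (Ioi (0 : ℝ))),
          ‖F t‖ * (∫ z in Ioi (0 : ℝ), ‖K z‖) = ∫ z in Ioi (0 : ℝ), ‖H (t, z)‖ := by
        filter_upwards [ae_restrict_mem measurableSet_Ioi] with t ht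
        have ht' : (0 : ℝ) < t := ht
        simp only [hH, norm_mul]
        rw [integral_const_mul, integral_mul_const, hsecI (fun z => ‖K z‖) t ht]
        rw [norm_inv, Complex.norm_real, Real.norm_of_nonneg ht'.le, smul_eq_mul]
        field_simp
      exact (hFi.norm.mul_const _).congr this
  have hkey : ∀ t z : ℝ, 0 < t → 0 < z →
      H (t, z) = (z : ℂ) ^ (s - 1) * (f t * g (z / t) / t) := by
    intro t z ht hz
    have h1 : (z : ℂ) ^ (s - 1) = (t : ℂ) ^ (s - 1) * ((z * t⁻¹ : ℝ) : ℂ) ^ (s - 1) := by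
      rw [← Complex.mul_cpow_ofReal_nonneg ht.le (by positivity)]
      congr 1
      rw [← Complex.ofReal_mul]
      congr 1
      field_simp
    simp only [hH, hF, hK, h1, div_eq_mul_inv]
    ring
  have hswap := hint.swap
  have hz : ∀ᵐ z ∂(volume.restrict (Ioi (0 : ℝ))), ∫ t in Ioi (0 : ℝ), H (t, z) =
      (z : ℂ) ^ (s - 1) • ∫ t in Ioi (0 : ℝ), f t * g (z / t) / t := by
    filter_upwards [ae_restrict_mem measurableSet_Ioi] with z hz
    rw [smul_eq_mul, ← integral_const_mul]
    exact setIntegral_congr_fun measurableSet_Ioi fun t ht => hkey t z ht hz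
  constructor
  · exact (hint.integral_prod_right).congr hz
  · rw [mellin, ← integral_congr_ae hz, integral_integral_swap (f := fun z t => H (t, z)) hswap]
    have : ∀ᵐ t ∂(volume.restrict (Ioi (0 : ℝ))), ∫ z in Ioi (0 : ℝ), H (t, z) =
        F t * ∫ z in Ioi (0 : ℝ), K z := by
      filter_upwards [ae_restrict_mem measurableSet_Ioi] with t ht
      have ht' : (t : ℂ) ≠ 0 := by exact_mod_cast (ne_of_gt ht)
      simp only [hH]
      rw [integral_const_mul, integral_mul_const, hsecI K t ht, Complex.real_smul]
      field_simp
    rw [integral_congr_ae this, integral_mul_const]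
    rfl

theorem hasMellin_congr {f g : ℝ → ℂ} {s m : ℂ} (hf : HasMellin f s m)
    (h : ∀ t : ℝ, 0 < t → f t = g t) : HasMellin g s m := by
  obtain ⟨hf, rfl⟩ := hf
  have : EqOn (fun t : ℝ => (t : ℂ) ^ (s - 1) • f t) (fun t : ℝ => (t : ℂ) ^ (s - 1) • g t)
      (Ioi 0) := fun t ht => by simp only [h t ht]
  exact ⟨(integrableOn_congr_fun this measurableSet_Ioi).1 hf,
    (setIntegral_congr_fun measurableSet_Ioi this).symm⟩

theorem hasMellin_comp_inv {f : ℝ → ℂ} {s m : ℂ} (hf : HasMellin f (-s) m) :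
    HasMellin (fun t => f t⁻¹) s m := by
  obtain ⟨hf, rfl⟩ := hf
  refine ⟨?_, mellin_comp_inv f s⟩
  have := MellinConvergent.comp_rpow (f := f) (s := s) (a := -1) (by norm_num)
  simp only [Real.rpow_neg_one] at this
  exact this.2 (by simpa [div_neg] using hf)

theorem hasMellin_rpow_mul {f : ℝ → ℂ} {s m : ℂ} (a : ℝ) (hf : HasMellin f (s + a) m) :
    HasMellin (fun t => ((t ^ a : ℝ) : ℂ) * f t) s m := by
  obtain ⟨hf, rfl⟩ := hf
  refine hasMellin_congr (f := fun t => (t : ℂ) ^ (a : ℂ) • f t)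
    ⟨MellinConvergent.cpow_smul.2 hf, mellin_cpow_smul f s a⟩ fun t ht => ?_
  rw [smul_eq_mul, Complex.ofReal_cpow ht.le]

/-! ### Weighted primitives: Mellin transform, continuity, termwise integration -/

/-- The weighted primitive `z ↦ z ^ (-Ψ) ∫₀ᶻ f t t ^ (Ψ - 1) dt`. -/
def weightedPrimitive (Ψ : ℝ) (f : ℝ → ℝ) (z : ℝ) : ℝ :=
  z ^ (-Ψ) * ∫ t in Ioc 0 z, f t * t ^ (Ψ - 1)

/-- Because z^(-Ψ) t^(Ψ-1) = (t/z)^Ψ / t, integrating over t ≤ z is a multiplicative convolution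
with a truncated power of z/t. Measurability and the Mellin transform both follow from this form. -/
theorem weightedPrimitive_ofReal_eq (Ψ : ℝ) (f : ℝ → ℝ) (z : ℝ) :
    ((weightedPrimitive Ψ f z : ℝ) : ℂ) =
      ∫ t in Ioi (0 : ℝ), (f t : ℂ) *
        ((fun u : ℝ => (((Ioc (0 : ℝ) 1).indicator (fun t => t ^ Ψ) u⁻¹ : ℝ) : ℂ)) (z / t)) / t := by
  have h1 : ∀ t ∈ Ioi (0 : ℝ), (f t : ℂ) *
        ((fun u : ℝ => (((Ioc (0 : ℝ) 1).indicator (fun t => t ^ Ψ) u⁻¹ : ℝ) : ℂ)) (z / t)) / t =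
      (((Ioc 0 z).indicator (fun t => z ^ (-Ψ) * (f t * t ^ (Ψ - 1))) t : ℝ) : ℂ) := by
    intro t ht
    have ht : 0 < t := ht
    -- No sign condition on z is needed: for z ≤ 0 both memberships fail and both sides of the
    -- identity vanish.
    have hiff : (z / t)⁻¹ ∈ Ioc (0 : ℝ) 1 ↔ t ∈ Ioc 0 z := by
      rw [inv_div, mem_Ioc, mem_Ioc]
      constructor
      · rintro ⟨h, h'⟩
        have hz : 0 < z := (div_pos_iff_of_pos_left ht).1 h
        exact ⟨ht, (div_le_one hz).1 h'⟩
      · rintro ⟨h, h'⟩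
        have hz : 0 < z := h.trans_le h'
        exact ⟨by positivity, (div_le_one hz).2 h'⟩
    by_cases hmem : t ∈ Ioc 0 z
    · have hz : 0 < z := hmem.1.trans_le hmem.2
      simp only [indicator_of_mem hmem, indicator_of_mem (hiff.2 hmem)]
      rw [inv_div, Real.div_rpow ht.le hz.le, Real.rpow_sub_one ht.ne', Real.rpow_neg hz.le]
      push_cast
      ring
    · simp only [indicator_of_notMem hmem, indicator_of_notMem (fun h => hmem (hiff.1 h))]
      simp
  rw [setIntegral_congr_fun measurableSet_Ioi h1, integral_complex_ofReal, weightedPrimitive,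
    ← integral_const_mul, setIntegral_indicator measurableSet_Ioc]
  congr 3
  exact (inter_eq_right.2 fun t ht => ht.1).symm

theorem hasMellin_indicator_inv_rpow {Ψ : ℝ} {s : ℂ} (hs : s.re < Ψ) :
    HasMellin (fun u : ℝ => (((Ioc (0 : ℝ) 1).indicator (fun t => t ^ Ψ) u⁻¹ : ℝ) : ℂ)) s
      (1 / (Ψ - s)) := by
  have h := hasMellin_cpow_Ioc (Ψ : ℂ) (s := -s) (by simp; linarith)
  have h2 : HasMellin (fun u : ℝ => (((Ioc (0 : ℝ) 1).indicator (fun t => t ^ Ψ) u : ℝ) : ℂ)) (-s)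
      (1 / (-s + Ψ)) := by
    refine hasMellin_congr h fun t ht => ?_
    by_cases hm : t ∈ Ioc (0 : ℝ) 1
    · simp only [indicator_of_mem hm, Complex.ofReal_cpow ht.le]
    · simp only [indicator_of_notMem hm, Complex.ofReal_zero]
  rw [show (Ψ : ℂ) - s = -s + Ψ by ring]
  exact hasMellin_comp_inv h2

theorem measurable_indicator_inv_rpow (Ψ : ℝ) :
    Measurable (fun u : ℝ => (((Ioc (0 : ℝ) 1).indicator (fun t => t ^ Ψ) u⁻¹ : ℝ) : ℂ)) := by
  have : Measurable ((Ioc (0 : ℝ) 1).indicator (fun t : ℝ => t ^ Ψ)) :=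
    Measurable.indicator (by fun_prop) measurableSet_Ioc
  fun_prop

theorem measurable_weightedPrimitive {Ψ : ℝ} {f : ℝ → ℝ} (hf : Measurable f) :
    Measurable (weightedPrimitive Ψ f) := by
  have h : Measurable fun z => ((weightedPrimitive Ψ f z : ℝ) : ℂ) := by
    simp only [weightedPrimitive_ofReal_eq]
    have := measurable_indicator_inv_rpow Ψ
    refine StronglyMeasurable.measurable (StronglyMeasurable.integral_prod_right ?_)
    apply Measurable.stronglyMeasurable
    apply Measurable.div
    · apply Measurable.mul
      · fun_prop
      · exact this.comp (by fun_prop)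
    · fun_prop
  exact Complex.measurable_re.comp h

/-- The multiplier 1/(Ψ - s) equals Γ(Ψ - s)/Γ(1 + Ψ - s), so one such pair of Gamma factors in a
kernel amounts to one integration. -/
theorem hasMellin_weightedPrimitive {Ψ : ℝ} {f : ℝ → ℝ} {s m : ℂ} (hfm : Measurable f)
    (hs : s.re < Ψ) (hf : HasMellin (fun t => (f t : ℂ)) s m) :
    HasMellin (fun z => (weightedPrimitive Ψ f z : ℂ)) s (m / (Ψ - s)) := by
  simp only [weightedPrimitive_ofReal_eq]
  have h := hasMellin_mulConvolution (f := fun t => (f t : ℂ)) (by fun_prop)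
    (measurable_indicator_inv_rpow Ψ) hf (hasMellin_indicator_inv_rpow hs)
  rw [mul_one_div] at h
  exact h

/-- On (0, z] the weight t^(Ψ-1) is at most z^(Ψ - Re s) t^(Re s - 1), so Mellin convergence at s
suffices. -/
theorem integrableOn_mul_rpow_of_hasMellin {Ψ : ℝ} {f : ℝ → ℝ} {s : ℂ} {m : ℂ}
    (hfm : Measurable f) (hs : s.re ≤ Ψ) (hf : HasMellin (fun t => (f t : ℂ)) s m) (z : ℝ) :
    IntegrableOn (fun t => f t * t ^ (Ψ - 1)) (Ioc 0 z) := by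
  have h : IntegrableOn (fun t : ℝ => (t : ℂ) ^ (s - 1) • (f t : ℂ)) (Ioc 0 z) :=
    hf.1.mono_set fun t ht => ht.1
  refine Integrable.mono' (g := fun t => z ^ (Ψ - s.re) * ‖(t : ℂ) ^ (s - 1) • (f t : ℂ)‖)
    (h.norm.const_mul _) (by fun_prop) ?_
  filter_upwards [ae_restrict_mem measurableSet_Ioc] with t ht
  have ht0 : 0 < t := ht.1
  rw [norm_smul, Complex.norm_cpow_eq_rpow_re_of_pos ht0, Complex.norm_real, norm_mul,
    Real.norm_of_nonneg (Real.rpow_nonneg ht0.le (Ψ - 1)),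
    show Ψ - 1 = (Ψ - s.re) + (s - 1).re by simp, Real.rpow_add ht0]
  have : t ^ (Ψ - s.re) ≤ z ^ (Ψ - s.re) := Real.rpow_le_rpow ht0.le ht.2 (by linarith)
  have h2 : 0 ≤ t ^ (s - 1).re * ‖f t‖ := by positivity
  nlinarith [mul_le_mul_of_nonneg_right this h2]

theorem continuousAt_weightedPrimitive {Ψ : ℝ} {f : ℝ → ℝ} {s : ℂ} {m : ℂ}
    (hfm : Measurable f) (hs : s.re ≤ Ψ) (hf : HasMellin (fun t => (f t : ℂ)) s m) {z : ℝ}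
    (hz : 0 < z) : ContinuousAt (weightedPrimitive Ψ f) z := by
  refine ContinuousAt.mul (Real.continuousAt_rpow_const _ _ (Or.inl hz.ne')) ?_
  have hi : IntervalIntegrable (fun t => f t * t ^ (Ψ - 1)) volume 0 (z + 1) :=
    (intervalIntegrable_iff_integrableOn_Ioc_of_le (by linarith)).2
      (integrableOn_mul_rpow_of_hasMellin hfm hs hf (z + 1))
  have hc := intervalIntegral.continuousOn_primitive_interval' hi (left_mem_uIcc)
  rw [uIcc_of_le (by linarith)] at hc
  have hc' := hc.continuousAt (x := z) (Icc_mem_nhds hz (by linarith))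
  refine hc'.congr ?_
  filter_upwards [Ioi_mem_nhds hz] with y hy
  exact intervalIntegral.integral_of_le (le_of_lt hy)

/-- Termwise integration of an expansion in powers at the origin. -/
theorem abs_weightedPrimitive_sub_sum_le {Ψ B d : ℝ} {f : ℝ → ℝ} {n : ℕ} {A c : ℕ → ℝ}
    (hc : ∀ k < n, 0 < c k + Ψ) (hd : 0 < d + Ψ)
    (h : ∀ t, 0 < t → |f t - ∑ k ∈ Finset.range n, A k * t ^ c k| ≤ B * t ^ d) {z : ℝ}
    (hz : 0 < z) (hf : IntegrableOn (fun t => f t * t ^ (Ψ - 1)) (Ioc 0 z)) :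
    |weightedPrimitive Ψ f z - ∑ k ∈ Finset.range n, A k / (c k + Ψ) * z ^ c k| ≤
      B / (d + Ψ) * z ^ d := by
  have hpi : ∀ e : ℝ, 0 < e + Ψ → IntegrableOn (fun t : ℝ => t ^ (e + Ψ - 1)) (Ioc 0 z) :=
    fun e he => (intervalIntegrable_iff_integrableOn_Ioc_of_le hz.le).1
      (intervalIntegral.intervalIntegrable_rpow' (by linarith))
  have hpv : ∀ e : ℝ, 0 < e + Ψ → ∫ t in Ioc 0 z, t ^ (e + Ψ - 1) = z ^ Ψ * z ^ e / (e + Ψ) := by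
    intro e he
    rw [← intervalIntegral.integral_of_le hz.le, integral_rpow (Or.inl (by linarith)),
      sub_add_cancel, Real.zero_rpow he.ne', sub_zero, Real.rpow_add hz, mul_comm (z ^ e)]
  have hsumi : Integrable (fun t : ℝ => ∑ k ∈ Finset.range n, A k * t ^ (c k + Ψ - 1))
      (volume.restrict (Ioc 0 z)) :=
    integrable_finsetSum _ fun k hk => (hpi _ (hc k (Finset.mem_range.1 hk))).const_mul _
  have hz1 : z ^ (-Ψ) * z ^ Ψ = 1 := by rw [← Real.rpow_add hz]; simp
  have hsum : ∑ k ∈ Finset.range n, A k / (c k + Ψ) * z ^ c k =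
      z ^ (-Ψ) * ∫ t in Ioc 0 z, ∑ k ∈ Finset.range n, A k * t ^ (c k + Ψ - 1) := by
    rw [integral_finsetSum _ fun k hk => (hpi _ (hc k (Finset.mem_range.1 hk))).const_mul _,
      Finset.mul_sum]
    refine Finset.sum_congr rfl fun k hk => ?_
    rw [integral_const_mul, hpv _ (hc k (Finset.mem_range.1 hk))]
    linear_combination -(A k / (c k + Ψ) * z ^ c k) * hz1
  have hB : B / (d + Ψ) * z ^ d = z ^ (-Ψ) * ∫ t in Ioc 0 z, B * t ^ (d + Ψ - 1) := by
    rw [integral_const_mul, hpv _ hd]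
    linear_combination -(B / (d + Ψ) * z ^ d) * hz1
  rw [hsum, hB, weightedPrimitive, ← mul_sub, ← integral_sub hf hsumi, abs_mul,
    abs_of_nonneg (Real.rpow_nonneg hz.le _)]
  refine mul_le_mul_of_nonneg_left ?_ (Real.rpow_nonneg hz.le _)
  rw [← Real.norm_eq_abs]
  refine norm_integral_le_of_norm_le ((hpi _ hd).const_mul _) ?_
  filter_upwards [ae_restrict_mem measurableSet_Ioc] with t ht
  have ht0 : 0 < t := ht.1
  have e1 : ∀ e : ℝ, t ^ (e + Ψ - 1) = t ^ e * t ^ (Ψ - 1) := fun e => by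
    rw [← Real.rpow_add ht0]; ring_nf
  simp only [e1]
  have := mul_le_mul_of_nonneg_right (h t ht0) (Real.rpow_nonneg ht0.le (Ψ - 1))
  rw [Real.norm_eq_abs]
  calc _ = |f t - ∑ k ∈ Finset.range n, A k * t ^ c k| * t ^ (Ψ - 1) := by
        rw [← abs_of_nonneg (Real.rpow_nonneg ht0.le (Ψ - 1)), ← abs_mul, sub_mul,
          Finset.sum_mul, abs_of_nonneg (Real.rpow_nonneg ht0.le (Ψ - 1))]
        simp only [mul_assoc]
    _ ≤ _ := by linarith

theorem integrableOn_Ioi_mul_rpow_of_hasMellin {σ : ℝ} {f : ℝ → ℝ} {m : ℂ}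
    (hf : HasMellin (fun t => (f t : ℂ)) σ m) :
    IntegrableOn (fun t => f t * t ^ (σ - 1)) (Ioi 0) := by
  have h := hf.1.re
  refine (integrableOn_congr_fun (fun t ht => ?_) measurableSet_Ioi).1 h
  rw [← Complex.ofReal_one, ← Complex.ofReal_sub, ← Complex.ofReal_cpow (le_of_lt ht), smul_eq_mul,
    ← Complex.ofReal_mul, mul_comm]
  rfl

theorem integral_Ioi_mul_rpow_of_hasMellin {σ : ℝ} {f : ℝ → ℝ} {m : ℂ}
    (hf : HasMellin (fun t => (f t : ℂ)) σ m) :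
    ((∫ t in Ioi (0 : ℝ), f t * t ^ (σ - 1) : ℝ) : ℂ) = m := by
  rw [← hf.2, mellin, ← integral_complex_ofReal]
  refine setIntegral_congr_fun measurableSet_Ioi fun t ht => ?_
  rw [← Complex.ofReal_one, ← Complex.ofReal_sub, ← Complex.ofReal_cpow (le_of_lt ht), smul_eq_mul,
    ← Complex.ofReal_mul, mul_comm]

/-! ### Decay on vertical lines and inversion -/

theorem norm_Gamma_le {s : ℂ} (hs : 0 < s.re) : ‖Complex.Gamma s‖ ≤ Real.Gamma s.re := by
  rw [Complex.Gamma_eq_integral hs, Complex.GammaIntegral, Real.Gamma_eq_integral hs]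
  refine norm_integral_le_of_norm_le (Real.GammaIntegral_convergent hs) ?_
  filter_upwards [ae_restrict_mem measurableSet_Ioi] with t ht
  rw [norm_mul, Complex.norm_cpow_eq_rpow_re_of_pos ht, Complex.norm_real,
    Real.norm_of_nonneg (Real.exp_pos _).le, Complex.sub_re, Complex.one_re]

/-- Γ(s + 2) = (s + 1) s Γ(s), where |s (s + 1)| ≥ (Im s)² and the left side is bounded by its value
at the real part. This is far weaker than the true exponential decay but enough for absolute
convergence. -/
theorem one_add_sq_mul_norm_Gamma_le {s : ℂ} (hs : 0 < s.re) :
    (1 + s.im ^ 2) * ‖Complex.Gamma s‖ ≤ Real.Gamma s.re + Real.Gamma (s.re + 2) := by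
  have h0 : s ≠ 0 := fun h => by simp [h] at hs
  have h1 : s + 1 ≠ 0 := fun h => by
    have := congrArg Complex.re h
    simp at this
    linarith
  have e : Complex.Gamma (s + 2) = (s + 1) * s * Complex.Gamma s := by
    rw [show s + 2 = s + 1 + 1 by ring, Complex.Gamma_add_one _ h1, Complex.Gamma_add_one _ h0]
    ring
  have h2 : ‖Complex.Gamma (s + 2)‖ ≤ Real.Gamma (s.re + 2) := by
    have := norm_Gamma_le (s := s + 2) (by simp; linarith)
    simpa using this
  rw [e, norm_mul, norm_mul] at h2
  have h3 : |s.im| ≤ ‖s‖ := Complex.abs_im_le_norm s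
  have h4 : |s.im| ≤ ‖s + 1‖ := by simpa using Complex.abs_im_le_norm (s + 1)
  have h5 : s.im ^ 2 ≤ ‖s + 1‖ * ‖s‖ := by
    rw [← sq_abs, sq]
    exact mul_le_mul h4 h3 (abs_nonneg _) (norm_nonneg _)
  nlinarith [norm_Gamma_le hs, mul_le_mul_of_nonneg_right h5 (norm_nonneg (Complex.Gamma s))]

/-- A function on the real line is continuous and decays like the inverse square. -/
def QuadraticDecay (f : ℝ → ℂ) : Prop :=
  Continuous f ∧ ∃ C, ∀ y, (1 + y ^ 2) * ‖f y‖ ≤ C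

theorem QuadraticDecay.integrable {f : ℝ → ℂ} (h : QuadraticDecay f) : Integrable f := by
  obtain ⟨hc, C, hC⟩ := h
  refine Integrable.mono' (g := fun y => C * (1 + y ^ 2)⁻¹) (integrable_inv_one_add_sq.const_mul C)
    hc.aestronglyMeasurable (Eventually.of_forall fun y => ?_)
  rw [← div_eq_mul_inv, le_div_iff₀ (by positivity)]
  linarith [hC y]

theorem QuadraticDecay.mul_of_le {f g : ℝ → ℂ} (h : QuadraticDecay f) (hg : Continuous g)
    {B : ℝ} (hB : ∀ y, ‖g y‖ ≤ B) : QuadraticDecay fun y => f y * g y := by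
  obtain ⟨hc, C, hC⟩ := h
  refine ⟨hc.mul hg, C * B, fun y => ?_⟩
  rw [norm_mul, ← mul_assoc]
  have h0 : 0 ≤ (1 + y ^ 2) * ‖f y‖ := by positivity
  exact mul_le_mul (hC y) (hB y) (norm_nonneg _) (h0.trans (hC y))

theorem QuadraticDecay.mul {f g : ℝ → ℂ} (h : QuadraticDecay f) (hg : QuadraticDecay g) :
    QuadraticDecay fun y => f y * g y := by
  obtain ⟨hc, C, hC⟩ := hg
  refine h.mul_of_le hc (B := C) fun y => le_trans ?_ (hC y)
  nlinarith [mul_nonneg (sq_nonneg y) (norm_nonneg (g y))]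

/-- The empty product is 1 and does not decay, hence `n ≠ 0`. -/
theorem QuadraticDecay.prod_range {F : ℕ → ℝ → ℂ} {n : ℕ} (hn : n ≠ 0)
    (h : ∀ k, QuadraticDecay (F k)) :
    QuadraticDecay fun y => ∏ k ∈ Finset.range n, F k y := by
  induction n with
  | zero => exact absurd rfl hn
  | succ n ih =>
    rcases eq_or_ne n 0 with rfl | hn'
    · simpa using h 0
    · simpa only [Finset.prod_range_succ] using (ih hn').mul (h n)

/-- Fixing only the square of the imaginary part covers both orientations, Γ(b + s) and Γ(1 - a -
s). -/
theorem quadraticDecay_Gamma {u : ℝ → ℂ} {x : ℝ} (hx : 0 < x) (hu : Continuous u)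
    (hre : ∀ y, (u y).re = x) (him : ∀ y, (u y).im ^ 2 = y ^ 2) :
    QuadraticDecay fun y => Complex.Gamma (u y) := by
  refine ⟨?_, Real.Gamma x + Real.Gamma (x + 2), fun y => ?_⟩
  · rw [continuous_iff_continuousAt]
    intro y
    refine (Complex.differentiableAt_Gamma _ fun m hm => ?_).continuousAt.comp hu.continuousAt
    have := congrArg Complex.re hm
    rw [hre] at this
    simp at this
    have : (0 : ℝ) ≤ m := m.cast_nonneg
    linarith
  · rw [← him y]
    have := one_add_sq_mul_norm_Gamma_le (s := u y) (by rw [hre]; exact hx)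
    rwa [hre] at this

theorem QuadraticDecay.div_of_re {f : ℝ → ℂ} (h : QuadraticDecay f) {u : ℝ → ℂ} {x : ℝ}
    (hx : x ≠ 0) (hu : Continuous u) (hre : ∀ y, (u y).re = x) :
    QuadraticDecay fun y => f y / u y := by
  simp only [div_eq_mul_inv]
  have h0 : ∀ y, u y ≠ 0 := fun y h => hx (by rw [← hre y, h]; rfl)
  refine h.mul_of_le (hu.inv₀ h0) (B := |x|⁻¹) fun y => ?_
  rw [norm_inv]
  refine inv_anti₀ (abs_pos.2 hx) ?_
  rw [← hre y]
  exact Complex.abs_re_le_norm _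

theorem separatesPoles_meijerAbscissa {an bm : List ℝ} (h : ∃ σ, SeparatesPoles an bm σ) :
    SeparatesPoles an bm (meijerAbscissa an bm) := by
  rw [meijerAbscissa, dif_pos h]
  exact h.choose_spec

/-- A function whose Mellin transform is the kernel of a Meijer G-function is this G-function. -/
theorem meijerG_eq {an ap bm bq : List ℝ} {f : ℝ → ℝ} (hsep : ∃ σ, SeparatesPoles an bm σ)
    (hf : ∀ s : ℂ, SeparatesPoles an bm s.re →
      HasMellin (fun t => (f t : ℂ)) s (meijerKernel an ap bm bq s))
    (hdec : ∀ σ : ℝ, SeparatesPoles an bm σ →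
      QuadraticDecay fun y => meijerKernel an ap bm bq (σ + y * Complex.I))
    {z : ℝ} (hz : 0 < z) (hc : ContinuousAt f z) : meijerG an ap bm bq z = f z := by
  -- The abscissa is an unspecified choice, known only to separate the poles; this is why `hf` and
  -- `hdec` range over the whole strip.
  have hσ := separatesPoles_meijerAbscissa hsep
  set σ := meijerAbscissa an bm with hσdef
  have hline : ∀ y : ℝ, meijerKernel an ap bm bq (σ + y * Complex.I) =
      mellin (fun t => (f t : ℂ)) (σ + y * Complex.I) := fun y =>
    ((hf (σ + y * Complex.I) (by simpa using hσ)).2).symm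
  have hinv := mellinInv_mellin_eq σ (fun t => (f t : ℂ)) hz
    (by simpa using (hf σ (by simpa using hσ)).1)
    (by
      have := (hdec σ hσ).integrable
      simp only [hline] at this
      exact this)
    (Complex.continuous_ofReal.continuousAt.comp hc)
  have : mellinInv σ (meijerKernel an ap bm bq) z =
      mellinInv σ (mellin fun t => (f t : ℂ)) z := by
    simp only [mellinInv, hline]
  rw [meijerG, ← hσdef, this, hinv, Complex.ofReal_re]

theorem hasMellin_exp_neg {s : ℂ} (hs : 0 < s.re) :
    HasMellin (fun t : ℝ => ((Real.exp (-t) : ℝ) : ℂ)) s (Complex.Gamma s) := by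
  have h := Complex.GammaIntegral_convergent hs
  have e : ∀ t : ℝ, ((Real.exp (-t) : ℝ) : ℂ) * (t : ℂ) ^ (s - 1) =
      (t : ℂ) ^ (s - 1) • ((Real.exp (-t) : ℝ) : ℂ) := fun t => by rw [smul_eq_mul, mul_comm]
  constructor
  · simp only [Complex.ofReal_exp, Complex.ofReal_neg] at *
    simpa only [MellinConvergent, e] using h
  · rw [Complex.Gamma_eq_integral hs, Complex.GammaIntegral, mellin]
    simp only [e]

theorem hasMellin_rpow_mul_exp_neg {c : ℝ} {s : ℂ} (hs : -c < s.re) :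
    HasMellin (fun t : ℝ => ((t ^ c * Real.exp (-t) : ℝ) : ℂ)) s (Complex.Gamma (c + s)) := by
  have h := hasMellin_rpow_mul c (hasMellin_exp_neg (s := s + c) (by simp; linarith))
  rw [add_comm (c : ℂ)]
  simpa only [Complex.ofReal_mul] using h

/-! ### The Meijer G-functions of the radio-frequency link -/

theorem meijerG_exp {z : ℝ} (hz : 0 < z) : meijerG [] [] [0] [] z = Real.exp (-z) := by
  refine meijerG_eq (f := fun t => Real.exp (-t)) ⟨1, by simp [SeparatesPoles]⟩ (fun s hs => ?_)
    (fun σ hσ => ?_) hz (by fun_prop)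
  · have h0 : 0 < s.re := by simpa [SeparatesPoles] using hs
    simpa [meijerKernel] using hasMellin_exp_neg h0
  · have h0 : 0 < σ := by simpa [SeparatesPoles] using hσ
    simp only [meijerKernel]
    simpa using quadraticDecay_Gamma (u := fun y : ℝ => (σ : ℂ) + y * Complex.I) h0 (by fun_prop)
      (by simp) (by simp)

/-- `z ^ (-Ψ)` times the incomplete Gamma function `γ(c + Ψ, z)`. -/
def gammaPrimitive (Ψ c : ℝ) : ℝ → ℝ := weightedPrimitive Ψ fun t => t ^ c * Real.exp (-t)

theorem measurable_gammaPrimitive (Ψ c : ℝ) : Measurable (gammaPrimitive Ψ c) :=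
  measurable_weightedPrimitive (by fun_prop)

theorem hasMellin_gammaPrimitive {Ψ c : ℝ} {s : ℂ} (hs : -c < s.re) (hs' : s.re < Ψ) :
    HasMellin (fun t => (gammaPrimitive Ψ c t : ℂ)) s (Complex.Gamma (c + s) / (Ψ - s)) :=
  hasMellin_weightedPrimitive (by fun_prop) hs' (hasMellin_rpow_mul_exp_neg hs)

theorem Gamma_div_Gamma_one_add {s : ℂ} (hs : 0 < s.re) :
    Complex.Gamma s / Complex.Gamma (1 + s) = 1 / s := by
  have h0 : s ≠ 0 := fun h => by simp [h] at hs
  have h1 := Complex.Gamma_ne_zero_of_re_pos hs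
  rw [add_comm, Complex.Gamma_add_one _ h0]
  field_simp

/-- The kernel reduces to Γ(c + s)/(Ψ - s): the transform of `t ^ c * exp (-t)` after one weighted
integration. -/
theorem meijerG_eq_gammaPrimitive {Ψ c z : ℝ} (hΨ : -c < Ψ) (hz : 0 < z) :
    meijerG [1 - Ψ] [] [c] [-Ψ] z = gammaPrimitive Ψ c z := by
  have hsep : ∀ σ : ℝ, SeparatesPoles [1 - Ψ] [c] σ ↔ -c < σ ∧ σ < Ψ := by
    intro σ; simp [SeparatesPoles]
  have hker : ∀ s : ℂ, s.re < Ψ → meijerKernel [1 - Ψ] [] [c] [-Ψ] s =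
      Complex.Gamma (c + s) / (Ψ - s) := by
    intro s hs
    have := Gamma_div_Gamma_one_add (s := Ψ - s) (by simpa using hs)
    simp only [meijerKernel, List.map_cons, List.map_nil, List.prod_cons, List.prod_nil, mul_one]
    push_cast
    rw [show (1 : ℂ) - (1 - Ψ) - s = Ψ - s by ring,
      show (1 : ℂ) - -Ψ - s = 1 + (Ψ - s) by ring, mul_div_assoc, this, mul_one_div]
  obtain ⟨σ₀, hσ₀⟩ := exists_between hΨ
  refine meijerG_eq ⟨σ₀, (hsep _).2 hσ₀⟩ (fun s hs => ?_) (fun σ hσ => ?_) hz ?_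
  · have hs := (hsep _).1 hs
    rw [hker s hs.2]
    exact hasMellin_gammaPrimitive hs.1 hs.2
  · have hσ := (hsep _).1 hσ
    have e : ∀ y : ℝ, meijerKernel [1 - Ψ] [] [c] [-Ψ] (σ + y * Complex.I) =
        Complex.Gamma (c + (σ + y * Complex.I)) / (Ψ - (σ + y * Complex.I)) :=
      fun y => hker _ (by simpa using hσ.2)
    simp only [e]
    exact (quadraticDecay_Gamma (u := fun y : ℝ => (c : ℂ) + (σ + y * Complex.I)) (x := c + σ)
      (by linarith) (by fun_prop) (by simp) (by simp)).div_of_re (x := Ψ - σ) (by linarith)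
      (by fun_prop) (by simp)
  · exact continuousAt_weightedPrimitive (by fun_prop) (by simpa using hσ₀.2.le)
      (hasMellin_rpow_mul_exp_neg (s := σ₀) (by simpa using hσ₀.1)) hz

/-- The extra pair Γ(-s)/Γ(1 - s) = 1/(0 - s) is a second integration, of weight 0, and it shrinks
the strip to -c < Re s < 0. -/
theorem meijerG_eq_weightedPrimitive_gammaPrimitive {Ψ c z : ℝ} (hΨ : 0 < Ψ) (hc : 0 < c)
    (hz : 0 < z) :
    meijerG [1 - Ψ, 1] [] [c] [0, -Ψ] z = weightedPrimitive 0 (gammaPrimitive Ψ c) z := by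
  have hsep : ∀ σ : ℝ, SeparatesPoles [1 - Ψ, 1] [c] σ ↔ -c < σ ∧ σ < 0 := by
    intro σ
    simp only [SeparatesPoles, List.mem_cons, List.not_mem_nil, or_false, forall_eq_or_imp,
      forall_eq, sub_sub_cancel, sub_self]
    exact ⟨fun h => ⟨h.1, h.2.2⟩, fun h => ⟨h.1, h.2.trans hΨ, h.2⟩⟩
  have hker : ∀ s : ℂ, s.re < 0 → meijerKernel [1 - Ψ, 1] [] [c] [0, -Ψ] s =
      Complex.Gamma (c + s) / (Ψ - s) / ((0 : ℝ) - s) := by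
    intro s hs
    have h1 := Gamma_div_Gamma_one_add (s := Ψ - s) (by simpa using hs.trans hΨ)
    have h2 := Gamma_div_Gamma_one_add (s := -s) (by simpa using hs)
    simp only [meijerKernel, List.map_cons, List.map_nil, List.prod_cons, List.prod_nil, mul_one]
    push_cast
    rw [show (1 : ℂ) - (1 - Ψ) - s = Ψ - s by ring, show (1 : ℂ) - 1 - s = -s by ring,
      show (1 : ℂ) - -Ψ - s = 1 + (Ψ - s) by ring, show (1 : ℂ) - 0 - s = 1 + -s by ring,
      show (0 : ℂ) - s = -s by ring,
      mul_comm (Complex.Gamma (Ψ - s)), ← mul_assoc, mul_div_mul_comm, h1, mul_div_assoc, h2]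
    ring
  have h0 : -c < -c / 2 ∧ -c / 2 < 0 := ⟨by linarith, by linarith⟩
  refine meijerG_eq ⟨-c / 2, (hsep _).2 h0⟩ (fun s hs => ?_) (fun σ hσ => ?_) hz ?_
  · have hs := (hsep _).1 hs
    rw [hker s hs.2]
    exact hasMellin_weightedPrimitive (measurable_gammaPrimitive _ _) hs.2
      (hasMellin_gammaPrimitive hs.1 (hs.2.trans hΨ))
  · have hσ := (hsep _).1 hσ
    have e : ∀ y : ℝ, meijerKernel [1 - Ψ, 1] [] [c] [0, -Ψ] (σ + y * Complex.I) =
        Complex.Gamma (c + (σ + y * Complex.I)) / (Ψ - (σ + y * Complex.I)) /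
          ((0 : ℝ) - (σ + y * Complex.I)) :=
      fun y => hker _ (by simpa using hσ.2)
    simp only [e]
    exact ((quadraticDecay_Gamma (u := fun y : ℝ => (c : ℂ) + (σ + y * Complex.I)) (x := c + σ)
      (by linarith) (by fun_prop) (by simp) (by simp)).div_of_re (x := Ψ - σ) (by linarith)
      (by fun_prop) (by simp)).div_of_re (x := 0 - σ) (by linarith) (by fun_prop) (by simp)
  · exact continuousAt_weightedPrimitive (s := ((-c / 2 : ℝ) : ℂ)) (measurable_gammaPrimitive _ _)
      (by rw [Complex.ofReal_re]; exact h0.2.le)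
      (hasMellin_gammaPrimitive (by rw [Complex.ofReal_re]; exact h0.1)
        (by rw [Complex.ofReal_re]; linarith)) hz

theorem integrableOn_gammaPrimitive {Ψ c : ℝ} (hΨ : 0 < Ψ) (hc : 0 < c) (z : ℝ) :
    IntegrableOn (fun t => gammaPrimitive Ψ c t * t ^ ((0 : ℝ) - 1)) (Ioc 0 z) :=
  integrableOn_mul_rpow_of_hasMellin (s := ((-c / 2 : ℝ) : ℂ)) (measurable_gammaPrimitive _ _)
    (by rw [Complex.ofReal_re]; linarith)
    (hasMellin_gammaPrimitive (by rw [Complex.ofReal_re]; linarith)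
        (by rw [Complex.ofReal_re]; linarith)) z

/-- The bracket 1 - u ≤ exp(-u) ≤ 1, multiplied by u^c and integrated termwise. -/
theorem abs_gammaPrimitive_sub_le {Ψ c t : ℝ} (hΨ : 0 < c + Ψ) (ht : 0 < t) :
    |gammaPrimitive Ψ c t - 1 / (c + Ψ) * t ^ c| ≤ 1 / (c + 1 + Ψ) * t ^ (c + 1) := by
  have h := abs_weightedPrimitive_sub_sum_le (Ψ := Ψ) (f := fun t => t ^ c * Real.exp (-t)) (n := 1)
    (A := fun _ => 1) (c := fun _ => c) (d := c + 1) (B := 1) (fun k _ => hΨ) (by linarith) ?_ ht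
    (integrableOn_mul_rpow_of_hasMellin (s := (Ψ : ℂ)) (by fun_prop)
      (by simp) (hasMellin_rpow_mul_exp_neg (by simp; linarith)) t)
  · simpa [gammaPrimitive] using h
  · intro u hu
    have h1 : 1 - u ≤ Real.exp (-u) := by linarith [Real.add_one_le_exp (-u)]
    have h2 : Real.exp (-u) ≤ 1 := Real.exp_le_one_iff.2 (by linarith)
    have h3 : 0 < u ^ c := Real.rpow_pos_of_pos hu c
    rw [Finset.sum_range_one, Real.rpow_add_one hu.ne', abs_le]
    constructor <;> nlinarith

theorem abs_weightedPrimitive_gammaPrimitive_sub_le {Ψ c z : ℝ} (hΨ : 0 < Ψ) (hc : 0 < c)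
    (hz : 0 < z) :
    |weightedPrimitive 0 (gammaPrimitive Ψ c) z - 1 / (c + Ψ) / c * z ^ c| ≤
      1 / (c + 1 + Ψ) / (c + 1) * z ^ (c + 1) := by
  have h := abs_weightedPrimitive_sub_sum_le (Ψ := 0) (f := gammaPrimitive Ψ c) (n := 1)
    (A := fun _ => 1 / (c + Ψ)) (c := fun _ => c) (d := c + 1) (B := 1 / (c + 1 + Ψ))
    (fun k _ => by linarith) (by linarith)
    (fun t ht => by
      simpa using abs_gammaPrimitive_sub_le (by linarith) ht) hz
    (integrableOn_gammaPrimitive hΨ hc z)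
  simpa using h

theorem isLittleO_rpow_rpow_nhdsGT {a b : ℝ} (h : a < b) :
    (fun z : ℝ => z ^ b) =o[𝓝[>] 0] fun z : ℝ => z ^ a := by
  refine (isLittleO_iff_tendsto' ?_).2 ?_
  · filter_upwards [self_mem_nhdsWithin] with z hz h0
    exact absurd h0 (Real.rpow_pos_of_pos hz a).ne'
  · have h1 : Tendsto (fun z : ℝ => z ^ (b - a)) (𝓝[>] 0) (𝓝 0) := by
      have := (Real.continuousAt_rpow_const 0 (b - a) (Or.inr (by linarith))).tendsto
      rw [Real.zero_rpow (by linarith)] at this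
      exact this.mono_left nhdsWithin_le_nhds
    refine h1.congr' ?_
    filter_upwards [self_mem_nhdsWithin] with z hz
    exact Real.rpow_sub hz b a

/-! ### Distribution function of the radio link and its leading term at the origin -/

namespace RFLink

variable (R : RFLink)

theorem Ψ_pos (i : Fin 3) : 0 < R.Ψ i := by
  have : 0 < rwpβ i + 1 := by fin_cases i <;> norm_num [rwpβ]
  exact div_pos this R.α_pos

theorem c_pos (k : ℕ) : 0 < R.c k := by
  have h1 : (0 : ℝ) < R.L := by exact_mod_cast R.L_pos
  have := mul_pos h1 R.μ_pos
  rw [c]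
  positivity

theorem K₂_pos {snr : ℝ} (h : 0 < snr) : 0 < R.K₂ snr := by
  have h1 : (0 : ℝ) < R.L := by exact_mod_cast R.L_pos
  have h2 := R.μ_pos
  have h3 := R.κ_pos
  have h4 := Real.rpow_pos_of_pos R.D_pos R.α
  have h5 := R.ϱ_pos
  rw [K₂, B]
  positivity

theorem G_eq (i : Fin 3) (k : ℕ) {z : ℝ} (hz : 0 < z) :
    R.G i k z = weightedPrimitive 0 (gammaPrimitive (R.Ψ i) (R.c k)) z :=
  meijerG_eq_weightedPrimitive_gammaPrimitive (R.Ψ_pos i) (R.c_pos k) hz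

theorem residue_eq (i : Fin 3) (k : ℕ) (z : ℝ) :
    R.residue i k z = 1 / (R.c k + R.Ψ i) / R.c k * z ^ R.c k := by
  have h1 := R.Ψ_pos i
  have h2 := R.c_pos k
  have h3 := Real.Gamma_pos_of_pos h2
  have h4 := Real.Gamma_pos_of_pos (add_pos h1 h2)
  rw [residue, zero_add, add_comm 1 (R.c k), add_assoc 1, add_comm 1 (_ + _),
    Real.Gamma_add_one h2.ne', Real.Gamma_add_one (add_pos h1 h2).ne']
  field_simp
  ring

theorem G_sub_residue_isBigO (i : Fin 3) (k : ℕ) :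
    (fun z => R.G i k z - R.residue i k z) =O[𝓝[>] 0] fun z : ℝ => z ^ (R.c k + 1) := by
  refine IsBigO.of_bound (1 / (R.c k + 1 + R.Ψ i) / (R.c k + 1)) ?_
  filter_upwards [self_mem_nhdsWithin] with z hz
  rw [R.G_eq i k hz, R.residue_eq, Real.norm_eq_abs, Real.norm_of_nonneg (Real.rpow_nonneg (le_of_lt hz) _)]
  exact abs_weightedPrimitive_gammaPrimitive_sub_le (R.Ψ_pos i) (R.c_pos k) hz

theorem G_isEquivalent_residue (i : Fin 3) (k : ℕ) : R.G i k ~[𝓝[>] 0] R.residue i k := by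
  have h1 := (R.G_sub_residue_isBigO i k).trans_isLittleO
    (isLittleO_rpow_rpow_nhdsGT (lt_add_one (R.c k)))
  have h2 := R.Ψ_pos i
  have h3 := R.c_pos k
  have h4 : (1 / (R.c k + R.Ψ i) / R.c k) ≠ 0 := by positivity
  have h5 : R.residue i k = fun z => 1 / (R.c k + R.Ψ i) / R.c k * z ^ R.c k :=
    funext (R.residue_eq i k)
  rw [IsEquivalent, h5, isLittleO_const_mul_right_iff h4, ← h5]
  exact h1

/-- The factor γ⁻¹ of the density is the weight t^(0-1), so the substitution v = K₂ u turns each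
term into the second primitive. -/
theorem cdf_eq (p : ℕ) {snr x : ℝ} (hsnr : 0 < snr) (hx : 0 < x) :
    R.cdf p snr x =
      ∑ i : Fin 3, ∑ k ∈ Finset.range (p + 1), R.K₁ p i k * R.G i k (R.K₂ snr * x) := by
  have hK := R.K₂_pos hsnr
  have hpdf : ∀ u ∈ Ioc 0 x, R.pdf p snr u = ∑ i : Fin 3, ∑ k ∈ Finset.range (p + 1),
      (R.K₁ p i k * R.K₂ snr) * (gammaPrimitive (R.Ψ i) (R.c k) (R.K₂ snr * u) *
        (R.K₂ snr * u) ^ ((0 : ℝ) - 1)) := by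
    intro u hu
    refine Finset.sum_congr rfl fun i _ => Finset.sum_congr rfl fun k _ => ?_
    have hu0 : 0 < u := hu.1
    rw [meijerG_eq_gammaPrimitive (by linarith [R.Ψ_pos i, R.c_pos k]) (mul_pos hK hu0), zero_sub,
      Real.rpow_neg_one]
    field_simp
  have hint : ∀ i k, IntervalIntegrable (fun u => gammaPrimitive (R.Ψ i) (R.c k) (R.K₂ snr * u) *
        (R.K₂ snr * u) ^ ((0 : ℝ) - 1)) volume 0 x := by
    intro i k
    have h := (intervalIntegrable_iff_integrableOn_Ioc_of_le (mul_pos hK hx).le).2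
      (integrableOn_gammaPrimitive (R.Ψ_pos i) (R.c_pos k) (R.K₂ snr * x))
    have h' := h.comp_mul_left (c := R.K₂ snr)
    rwa [zero_div, mul_div_cancel_left₀ _ hK.ne'] at h'
  have hinner : ∀ i, IntervalIntegrable (fun u => ∑ k ∈ Finset.range (p + 1),
      (R.K₁ p i k * R.K₂ snr) * (gammaPrimitive (R.Ψ i) (R.c k) (R.K₂ snr * u) *
        (R.K₂ snr * u) ^ ((0 : ℝ) - 1))) volume 0 x := by
    intro i
    have := IntervalIntegrable.sum (Finset.range (p + 1)) fun k _ =>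
      (hint i k).const_mul (R.K₁ p i k * R.K₂ snr)
    simpa only [Finset.sum_fn] using this
  rw [cdf, intervalIntegral.integral_of_le hx.le, setIntegral_congr_fun measurableSet_Ioc hpdf,
    ← intervalIntegral.integral_of_le hx.le,
    intervalIntegral.integral_finsetSum fun i _ => hinner i]
  refine Finset.sum_congr rfl fun i _ => ?_
  rw [intervalIntegral.integral_finsetSum fun k _ => (hint i k).const_mul _]
  refine Finset.sum_congr rfl fun k _ => ?_
  rw [intervalIntegral.integral_const_mul,
    intervalIntegral.integral_comp_mul_left (fun v => gammaPrimitive (R.Ψ i) (R.c k) v *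
        v ^ ((0 : ℝ) - 1)) hK.ne', R.G_eq i k (mul_pos hK hx), weightedPrimitive, mul_zero,
    intervalIntegral.integral_of_le (mul_pos hK hx).le, neg_zero, Real.rpow_zero, smul_eq_mul]
  field_simp

/-- The coefficient of the leading term of the distribution function at the origin. -/
theorem leadingCoefficient_pos (p : ℕ) (hp : 1 ≤ p) :
    0 < ∑ i : Fin 3, R.K₁ p i 0 * (1 / (R.c 0 + R.Ψ i) / R.c 0) := by
  have hα := R.α_pos
  have hc := R.c_pos 0
  have hp' : (0 : ℝ) < p := by exact_mod_cast hp
  have hV : 0 < besselV 0 p (R.L * R.μ - 1) := by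
    have h1 : 0 < Real.Gamma (R.c 0) := Real.Gamma_pos_of_pos hc
    have h2 := Real.Gamma_pos_of_pos hp'
    have h3 := Real.Gamma_pos_of_pos (by linarith : (0 : ℝ) < p + 1)
    have e : (R.L : ℝ) * R.μ - 1 + 0 + 1 = R.c 0 := by rw [c]; push_cast; ring
    simp only [besselV, Nat.cast_zero, add_zero, zero_add, Real.Gamma_one, sub_zero, one_mul]
    rw [add_zero] at e
    rw [e]
    positivity
  have hsum : 0 < ∑ i : Fin 3, rwpC i * (1 / (R.c 0 + R.Ψ i)) := by
    have hx : 0 < R.α * R.c 0 := mul_pos hα hc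
    have e : ∀ i, 1 / (R.c 0 + R.Ψ i) = R.α / (R.α * R.c 0 + (rwpβ i + 1)) := by
      intro i
      have := R.Ψ_pos i
      rw [Ψ] at this ⊢
      field_simp
    simp only [e, Fin.sum_univ_three, rwpC, rwpβ, Matrix.cons_val_zero, Matrix.cons_val_one,
      Matrix.cons_val]
    generalize R.α * R.c 0 = x at hx
    -- The middle coefficient is negative, so positivity is not termwise. The three coefficients sum
    -- to zero, which removes x² from the numerator; what remains has positive coefficients.
    have : 735 / 72 * (R.α / (x + (2 + 1))) + -1190 / 72 * (R.α / (x + (4 + 1))) +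
        455 / 72 * (R.α / (x + (6 + 1))) =
        R.α * (7560 + 560 * x) / (72 * ((x + 3) * (x + 5) * (x + 7))) := by
      field_simp
      ring
    rw [this]
    positivity
  have e : ∑ i : Fin 3, R.K₁ p i 0 * (1 / (R.c 0 + R.Ψ i) / R.c 0) =
      1 / (R.α * Real.exp (R.L * R.μ * R.κ)) * besselV 0 p (R.L * R.μ - 1) / R.c 0 *
        ∑ i : Fin 3, rwpC i * (1 / (R.c 0 + R.Ψ i)) := by
    rw [Finset.mul_sum]
    refine Finset.sum_congr rfl fun i _ => ?_
    rw [K₁, pow_zero]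
    ring
  rw [e]
  positivity

end RFLink

/-! ### The Meijer G-function of the optical links -/

/-- The constant of the Gauss multiplication formula. -/
def gaussConst (r : ℕ) : ℝ := (2 * Real.pi) ^ (((r : ℝ) - 1) / 2) / √(r : ℝ)

/-- A multiple of `exp (-r t ^ (1 / r))`. -/
def radicalExp (r : ℕ) (t : ℝ) : ℝ := gaussConst r * Real.exp (-(r * t ^ (1 / (r : ℝ))))

/-- The coefficients of the expansion of `radicalExp r` in powers of `t ^ (1 / r)`. -/
def radicalCoeff (r k : ℕ) : ℝ := gaussConst r * ((-r) ^ k / k.factorial)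

theorem measurable_radicalExp (r : ℕ) : Measurable (radicalExp r) := by
  unfold radicalExp; fun_prop

theorem gaussConst_pos {r : ℕ} (hr : 0 < r) : 0 < gaussConst r := by
  have := Real.pi_pos
  have : (0 : ℝ) < r := by exact_mod_cast hr
  unfold gaussConst
  positivity

theorem gaussConst_one : gaussConst 1 = 1 := by simp [gaussConst]

theorem gaussConst_two : gaussConst 2 = √Real.pi := by
  rw [gaussConst, show (((2 : ℕ) : ℝ) - 1) / 2 = 1 / 2 by norm_num, ← Real.sqrt_eq_rpow,
    Nat.cast_ofNat, Real.sqrt_mul zero_le_two]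
  field_simp

/-- The Mellin transform of `radicalExp r`, by the duplication formula. -/
theorem hasMellin_radicalExp {r : ℕ} (hr : r = 1 ∨ r = 2) {s : ℂ} (hs : 0 < s.re) :
    HasMellin (fun t => (radicalExp r t : ℂ)) s
      (∏ l ∈ Finset.range r, Complex.Gamma (s + ((l / r : ℝ) : ℂ))) := by
  rcases hr with rfl | rfl
  · simpa [radicalExp, gaussConst_one] using hasMellin_exp_neg hs
  · have h1 : HasMellin (fun t : ℝ => ((Real.exp (-(t ^ (1 / 2 : ℝ))) : ℝ) : ℂ)) s
        (2 * Complex.Gamma (2 * s)) := by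
      have hs2 : 0 < (s / ((1 / 2 : ℝ) : ℂ)).re := by
        rw [Complex.div_ofReal_re]
        positivity
      have h := hasMellin_exp_neg hs2
      refine ⟨(MellinConvergent.comp_rpow
        (f := fun t : ℝ => ((Real.exp (-t) : ℝ) : ℂ)) (by norm_num)).2 h.1, ?_⟩
      rw [mellin_comp_rpow (fun t : ℝ => ((Real.exp (-t) : ℝ) : ℂ)), h.2, Complex.real_smul,
        abs_of_pos (by norm_num)]
      push_cast
      rw [show s / (1 / 2) = 2 * s by ring]
      norm_num
    have h4 : (0 : ℝ) < 4 := by norm_num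
    -- Rescaling t by 4 contributes 4^(-s), which turns 2 Γ(2s) into Legendre's Γ(s) Γ(s + 1/2)
    -- after multiplication by √π.
    have h2 : HasMellin (fun t : ℝ => (√Real.pi : ℂ) •
        ((Real.exp (-((4 * t) ^ (1 / 2 : ℝ))) : ℝ) : ℂ)) s
          ((√Real.pi : ℂ) • ((4 : ℝ) : ℂ) ^ (-s) • (2 * Complex.Gamma (2 * s))) := by
      have h := (MellinConvergent.comp_mul_left
          (f := fun t : ℝ => ((Real.exp (-(t ^ (1 / 2 : ℝ))) : ℝ) : ℂ)) h4).2 h1.1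
      have h' := hasMellin_const_smul h (√Real.pi : ℂ)
      rwa [mellin_comp_mul_left (fun t : ℝ => ((Real.exp (-(t ^ (1 / 2 : ℝ))) : ℝ) : ℂ)) s h4,
        h1.2] at h'
    have e : (√Real.pi : ℂ) • ((4 : ℝ) : ℂ) ^ (-s) • (2 * Complex.Gamma (2 * s)) =
        ∏ l ∈ Finset.range 2, Complex.Gamma (s + ((l / (2 : ℕ) : ℝ) : ℂ)) := by
      have h := Complex.Gamma_mul_Gamma_add_half s
      have h5 : (4 : ℂ) ^ (-s) * 2 = 2 ^ (1 - 2 * s) := by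
        rw [show (4 : ℂ) = ((2 * 2 : ℝ) : ℂ) by norm_num, Complex.ofReal_mul,
          Complex.mul_cpow_ofReal_nonneg zero_le_two zero_le_two, Complex.ofReal_ofNat,
          ← Complex.cpow_add _ _ two_ne_zero, show (1 : ℂ) - 2 * s = (-s + -s) + 1 by ring,
          Complex.cpow_add (-s + -s) 1 two_ne_zero, Complex.cpow_one]
      simp only [Finset.prod_range_succ, Finset.prod_range_zero, one_mul, smul_eq_mul,
        Nat.cast_zero, zero_div, Complex.ofReal_zero, add_zero, Nat.cast_one, Nat.cast_ofNat,
        Complex.ofReal_div, Complex.ofReal_one, Complex.ofReal_ofNat]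
      rw [h, ← h5]
      ring
    rw [← e]
    refine hasMellin_congr h2 fun t ht => ?_
    rw [radicalExp, gaussConst_two, smul_eq_mul, ← Complex.ofReal_mul, Real.mul_rpow h4.le ht.le,
      show (4 : ℝ) ^ (1 / 2 : ℝ) = 2 by
        rw [← Real.sqrt_eq_rpow, show (4 : ℝ) = 2 ^ 2 by norm_num, Real.sqrt_sq zero_le_two]]
    norm_num

/-- The retained powers are exactly those with exponent below 1, so the first omitted one is of
order t. -/
theorem abs_radicalExp_sub_sum_le {r : ℕ} (hr : r = 1 ∨ r = 2) {t : ℝ} (ht : 0 < t) :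
    |radicalExp r t - ∑ k ∈ Finset.range r, radicalCoeff r k * t ^ (k / r : ℝ)| ≤
      gaussConst r * r ^ r * t := by
  rcases hr with rfl | rfl
  · have h1 : 1 - t ≤ Real.exp (-t) := by linarith [Real.add_one_le_exp (-t)]
    have h2 : Real.exp (-t) ≤ 1 := Real.exp_le_one_iff.2 (by linarith)
    simp only [radicalExp, radicalCoeff, gaussConst_one, Finset.sum_range_one]
    norm_num
    rw [abs_le]
    constructor <;> linarith
  · set v := t ^ (1 / 2 : ℝ) with hv
    have hv0 : 0 < v := Real.rpow_pos_of_pos ht _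
    have hvt : v ^ 2 = t := by
      rw [hv, ← Real.sqrt_eq_rpow, Real.sq_sqrt ht.le]
    have h1 : 1 - 2 * v ≤ Real.exp (-(2 * v)) := by linarith [Real.add_one_le_exp (-(2 * v))]
    -- From exp(-2v)(1 + 2v) ≤ 1, because (1 - 2v + 4v²)(1 + 2v) = 1 + 8v³ > 1.
    have h2 : Real.exp (-(2 * v)) ≤ 1 - 2 * v + 4 * v ^ 2 := by
      have h3 : Real.exp (-(2 * v)) * (1 + 2 * v) ≤ 1 := by
        calc _ ≤ Real.exp (-(2 * v)) * Real.exp (2 * v) := by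
              gcongr
              linarith [Real.add_one_le_exp (2 * v)]
          _ = 1 := by rw [← Real.exp_add]; simp
      by_contra! h4
      have := mul_lt_mul_of_pos_right h4 (by linarith : 0 < 1 + 2 * v)
      nlinarith [pow_pos hv0 3]
    have hC : 0 < gaussConst 2 := gaussConst_pos two_pos
    have e : radicalExp 2 t - ∑ k ∈ Finset.range 2, radicalCoeff 2 k * t ^ (k / (2 : ℕ) : ℝ) =
        gaussConst 2 * (Real.exp (-(2 * v)) - (1 - 2 * v)) := by
      simp only [radicalExp, radicalCoeff, Finset.sum_range_succ, Finset.sum_range_zero,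
        Nat.cast_zero, zero_div, Real.rpow_zero, Nat.cast_one, Nat.cast_ofNat, ← hv,
        Nat.factorial]
      push_cast
      ring
    rw [e, abs_mul, abs_of_pos hC, abs_of_nonneg (by linarith), mul_assoc]
    refine mul_le_mul_of_nonneg_left ?_ hC.le
    push_cast
    linarith

/-- The primitive of `t ^ (a - 1) radicalExp r t`. -/
def radicalPrimitive (r : ℕ) (a : ℝ) : ℝ → ℝ := weightedPrimitive 0 fun t => t ^ a * radicalExp r t

theorem measurable_radicalPrimitive (r : ℕ) (a : ℝ) : Measurable (radicalPrimitive r a) :=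
  measurable_weightedPrimitive (by have := measurable_radicalExp r; fun_prop)

theorem hasMellin_rpow_mul_radicalExp {r : ℕ} (hr : r = 1 ∨ r = 2) {a : ℝ} {s : ℂ}
    (hs : -a < s.re) : HasMellin (fun t => ((t ^ a * radicalExp r t : ℝ) : ℂ)) s
      (∏ l ∈ Finset.range r, Complex.Gamma (s + a + ((l / r : ℝ) : ℂ))) := by
  have h := hasMellin_rpow_mul a (hasMellin_radicalExp hr (s := s + a) (by simp; linarith))
  simpa only [Complex.ofReal_mul] using h

theorem measurable_rpow_mul_radicalExp (r : ℕ) (a : ℝ) :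
    Measurable fun t : ℝ => t ^ a * radicalExp r t := by
  have := measurable_radicalExp r
  fun_prop

theorem continuousAt_radicalPrimitive {r : ℕ} (hr : r = 1 ∨ r = 2) {a x : ℝ} (ha : 0 < a)
    (hx : 0 < x) : ContinuousAt (radicalPrimitive r a) x :=
  continuousAt_weightedPrimitive (s := ((0 : ℝ) : ℂ)) (measurable_rpow_mul_radicalExp r a) (by simp)
    (hasMellin_rpow_mul_radicalExp hr (by simpa using ha)) hx

/-- A bound independent of x, which provides the domination for integrability and continuity of the
convolution. -/
theorem abs_radicalPrimitive_le {r : ℕ} (hr : r = 1 ∨ r = 2) {a : ℝ} (ha : 0 < a) (x : ℝ) :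
    |radicalPrimitive r a x| ≤
      ∫ t in Ioi (0 : ℝ), |t ^ a * radicalExp r t * t ^ ((0 : ℝ) - 1)| := by
  have h := integrableOn_Ioi_mul_rpow_of_hasMellin (σ := 0)
    (hasMellin_rpow_mul_radicalExp hr (a := a) (by simpa using ha))
  rw [radicalPrimitive, weightedPrimitive, neg_zero, Real.rpow_zero, one_mul]
  exact abs_integral_le_integral_abs.trans
    (setIntegral_mono_set h.abs (Eventually.of_forall fun _ => abs_nonneg _)
      (Eventually.of_forall fun _ ht => ht.1))

theorem abs_radicalPrimitive_sub_sum_le {r : ℕ} (hr : r = 1 ∨ r = 2) {a x : ℝ} (ha : 0 < a)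
    (hx : 0 < x) :
    |radicalPrimitive r a x -
        ∑ k ∈ Finset.range r, radicalCoeff r k / (a + k / r) * x ^ (a + k / r : ℝ)| ≤
      gaussConst r * r ^ r / (a + 1) * x ^ (a + 1) := by
  have h := abs_weightedPrimitive_sub_sum_le (Ψ := 0) (f := fun t => t ^ a * radicalExp r t)
    (n := r) (A := radicalCoeff r) (c := fun k => a + k / r) (d := a + 1)
    (B := gaussConst r * r ^ r) (fun k _ => by positivity) (by linarith) ?_ hx
    (integrableOn_mul_rpow_of_hasMellin (s := ((0 : ℝ) : ℂ)) (measurable_rpow_mul_radicalExp r a)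
      (by simp) (hasMellin_rpow_mul_radicalExp hr (by simpa using ha)) x)
  · simpa only [radicalPrimitive, add_zero] using h
  · intro t ht
    have h1 : t ^ a * radicalExp r t - ∑ k ∈ Finset.range r, radicalCoeff r k * t ^ (a + k / r : ℝ) =
        t ^ a * (radicalExp r t - ∑ k ∈ Finset.range r, radicalCoeff r k * t ^ (k / r : ℝ)) := by
      rw [mul_sub, Finset.mul_sum]
      congr 1
      refine Finset.sum_congr rfl fun k _ => ?_
      rw [Real.rpow_add ht]
      ring
    have h2 := Real.rpow_pos_of_pos ht a
    rw [h1, abs_mul, abs_of_pos h2, Real.rpow_add_one ht.ne']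
    have := mul_le_mul_of_nonneg_left (abs_radicalExp_sub_sum_le hr ht) h2.le
    linarith

/-- Inverting the argument reflects s, which creates the factors Γ(1 - a' - s) of the kernel; the
power u^(-b) shifts s by b, and the primitive contributes 1/(s - b). -/
theorem hasMellin_rpow_mul_radicalPrimitive_inv {r : ℕ} (hr : r = 1 ∨ r = 2) {a b : ℝ} {s : ℂ}
    (hs : b < s.re) (hs' : s.re < a + b) :
    HasMellin (fun u => ((u ^ (-b) * radicalPrimitive r a u⁻¹ : ℝ) : ℂ)) s
      ((∏ l ∈ Finset.range r, Complex.Gamma (-(s - b) + a + ((l / r : ℝ) : ℂ))) / (s - b)) := by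
  have h := hasMellin_weightedPrimitive (Ψ := 0) (s := -(s - b))
    (measurable_rpow_mul_radicalExp r a) (by simpa using hs)
    (hasMellin_rpow_mul_radicalExp hr (a := a) (by simpa using hs'))
  have h' := hasMellin_rpow_mul (-b) (s := s) (hasMellin_comp_inv
    (s := s + ((-b : ℝ) : ℂ)) (by simpa [sub_eq_add_neg] using h))
  simpa [sub_eq_add_neg, radicalPrimitive] using h'

/-- The multiplicative convolution of `radicalExp r'` with `u ^ (-b) radicalPrimitive r a u⁻¹`. -/
def opticalConvolution (r r' : ℕ) (a b z : ℝ) : ℝ :=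
  ∫ t in Ioi (0 : ℝ), radicalExp r' t * ((z / t) ^ (-b) * radicalPrimitive r a (z / t)⁻¹) / t

theorem hasMellin_opticalConvolution {r r' : ℕ} (hr : r = 1 ∨ r = 2) (hr' : r' = 1 ∨ r' = 2)
    {a b : ℝ} {s : ℂ} (hb : 0 < b) (hs : b < s.re) (hs' : s.re < a + b) :
    HasMellin (fun z => (opticalConvolution r r' a b z : ℂ)) s
      ((∏ l ∈ Finset.range r', Complex.Gamma (s + ((l / r' : ℝ) : ℂ))) *
      ((∏ l ∈ Finset.range r, Complex.Gamma (-(s - b) + a + ((l / r : ℝ) : ℂ))) / (s - b))) := by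
  have hm := measurable_radicalExp r'
  have hm' := measurable_radicalPrimitive r a
  have h := hasMellin_mulConvolution (f := fun t => (radicalExp r' t : ℂ))
    (g := fun u => ((u ^ (-b) * radicalPrimitive r a u⁻¹ : ℝ) : ℂ)) (by fun_prop) (by fun_prop)
    (hasMellin_radicalExp hr' (hb.trans hs)) (hasMellin_rpow_mul_radicalPrimitive_inv hr hs hs')
  refine hasMellin_congr h fun t _ => ?_
  rw [opticalConvolution, ← integral_complex_ofReal]
  simp only [Complex.ofReal_mul, Complex.ofReal_div]

theorem opticalConvolution_eq (r r' : ℕ) (a b : ℝ) {z : ℝ} (hz : 0 < z) :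
    opticalConvolution r r' a b z = z ^ (-b) *
      ∫ t in Ioi (0 : ℝ), radicalExp r' t * t ^ (b - 1) * radicalPrimitive r a (t * z⁻¹) := by
  rw [opticalConvolution, ← integral_const_mul]
  refine setIntegral_congr_fun measurableSet_Ioi fun t ht => ?_
  have ht : 0 < t := ht
  rw [inv_div, Real.div_rpow hz.le ht.le, Real.rpow_sub_one ht.ne', Real.rpow_neg ht.le b,
    div_inv_eq_mul, div_eq_mul_inv t z]
  ring

theorem integrableOn_radicalExp_mul_rpow {r : ℕ} (hr : r = 1 ∨ r = 2) {e : ℝ} (he : 0 < e) :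
    IntegrableOn (fun t => radicalExp r t * t ^ (e - 1)) (Ioi 0) :=
  integrableOn_Ioi_mul_rpow_of_hasMellin (hasMellin_radicalExp hr (by simpa using he))

theorem integral_radicalExp_mul_rpow {r : ℕ} (hr : r = 1 ∨ r = 2) {e : ℝ} (he : 0 < e) :
    ∫ t in Ioi (0 : ℝ), radicalExp r t * t ^ (e - 1) =
      ∏ l ∈ Finset.range r, Real.Gamma (e + l / r) := by
  have h := integral_Ioi_mul_rpow_of_hasMellin (σ := e)
    (hasMellin_radicalExp hr (by simpa using he))
  rw [← Complex.ofReal_inj, h, Complex.ofReal_prod]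
  refine Finset.prod_congr rfl fun l _ => ?_
  rw [← Complex.ofReal_add, Complex.Gamma_ofReal]

theorem integrableOn_radicalExp_mul_radicalPrimitive {r r' : ℕ} (hr : r = 1 ∨ r = 2)
    (hr' : r' = 1 ∨ r' = 2) {a b : ℝ} (ha : 0 < a) (hb : 0 < b) (x : ℝ) :
    IntegrableOn (fun t => radicalExp r' t * t ^ (b - 1) * radicalPrimitive r a (t * x))
      (Ioi 0) := by
  have hm := measurable_radicalPrimitive r a
  refine (integrableOn_radicalExp_mul_rpow hr' hb).mul_bdd
    (c := ∫ t in Ioi (0 : ℝ), |t ^ a * radicalExp r t * t ^ ((0 : ℝ) - 1)|) (hm.comp (measurable_mul_const x)).aestronglyMeasurable ?_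
  exact Eventually.of_forall fun t => abs_radicalPrimitive_le hr ha _

theorem continuousAt_opticalConvolution {r r' : ℕ} (hr : r = 1 ∨ r = 2) (hr' : r' = 1 ∨ r' = 2)
    {a b : ℝ} (ha : 0 < a) (hb : 0 < b) {z : ℝ} (hz : 0 < z) :
    ContinuousAt (opticalConvolution r r' a b) z := by
  have h : ContinuousAt (fun z : ℝ => z ^ (-b) *
      ∫ t in Ioi (0 : ℝ), radicalExp r' t * t ^ (b - 1) * radicalPrimitive r a (t * z⁻¹)) z := by
    refine (Real.continuousAt_rpow_const _ _ (Or.inl hz.ne')).mul ?_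
    refine continuousAt_of_dominated (bound := fun t => ‖radicalExp r' t * t ^ (b - 1)‖ *
      ∫ t in Ioi (0 : ℝ), |t ^ a * radicalExp r t * t ^ ((0 : ℝ) - 1)|) ?_ ?_ ?_ ?_
    · exact Eventually.of_forall fun x =>
        (integrableOn_radicalExp_mul_radicalPrimitive hr hr' ha hb x⁻¹).aestronglyMeasurable
    · refine Eventually.of_forall fun x => Eventually.of_forall fun t => ?_
      rw [norm_mul]
      exact mul_le_mul_of_nonneg_left (abs_radicalPrimitive_le hr ha _) (norm_nonneg _)
    · exact (integrableOn_radicalExp_mul_rpow hr' hb).norm.mul_const _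
    · filter_upwards [ae_restrict_mem measurableSet_Ioi] with t ht
      have hc := continuousAt_radicalPrimitive hr ha (mul_pos ht (inv_pos.2 hz))
      have hi : ContinuousAt (fun x : ℝ => t * x⁻¹) z := (continuousAt_inv₀ hz.ne').const_mul t
      exact (ContinuousAt.comp (f := fun x : ℝ => t * x⁻¹) (x := z) hc hi).const_mul _
  refine h.congr ?_
  filter_upwards [Ioi_mem_nhds hz] with x hx
  exact (opticalConvolution_eq r r' a b hx).symm

/-- The expansion at infinity. -/
theorem abs_opticalConvolution_sub_sum_le {r r' : ℕ} (hr : r = 1 ∨ r = 2) (hr' : r' = 1 ∨ r' = 2)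
    {a b : ℝ} (ha : 0 < a) (hb : 0 < b) {z : ℝ} (hz : 0 < z) :
    |opticalConvolution r r' a b z - ∑ k ∈ Finset.range r, z ^ (-(a + b) - k / r) *
        (radicalCoeff r k / (a + k / r) *
          ∏ l ∈ Finset.range r', Real.Gamma (a + b + k / r + l / r'))| ≤
      gaussConst r * r ^ r / (a + 1) * (∏ l ∈ Finset.range r', Real.Gamma (a + b + 1 + l / r')) *
        z ^ (-(a + b) - 1) := by
  have hzb := Real.rpow_nonneg hz.le (-b)
  -- For large z the primitive is expanded at the small argument t/z; each power then integrates to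
  -- a moment of `radicalExp r'`, a product of Gamma values.
  have hpow : ∀ e : ℝ, ∀ t ∈ Ioi (0 : ℝ), radicalExp r' t * t ^ (b - 1) * (t * z⁻¹) ^ e =
      z ^ (-e) * (radicalExp r' t * t ^ (e + b - 1)) := by
    intro e t ht
    rw [Real.mul_rpow (le_of_lt ht) (inv_nonneg.2 hz.le), Real.inv_rpow hz.le, ← Real.rpow_neg hz.le,
      show e + b - 1 = (b - 1) + e by ring, Real.rpow_add ht]
    ring
  have hint : ∀ e : ℝ, 0 < e →
      IntegrableOn (fun t => radicalExp r' t * t ^ (b - 1) * (t * z⁻¹) ^ e) (Ioi 0) := fun e he =>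
    (integrableOn_congr_fun (hpow e) measurableSet_Ioi).2
      ((integrableOn_radicalExp_mul_rpow hr' (by linarith)).const_mul _)
  have hval : ∀ e : ℝ, 0 < e →
      ∫ t in Ioi (0 : ℝ), radicalExp r' t * t ^ (b - 1) * (t * z⁻¹) ^ e =
        z ^ (-e) * ∏ l ∈ Finset.range r', Real.Gamma (e + b + l / r') := fun e he => by
    rw [setIntegral_congr_fun measurableSet_Ioi (hpow e), integral_const_mul,
      integral_radicalExp_mul_rpow hr' (by linarith)]
  have hak : ∀ k : ℕ, 0 < a + (k : ℝ) / r := fun k => by positivity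
  have hsumi : Integrable (fun t : ℝ => ∑ k ∈ Finset.range r, radicalCoeff r k / (a + k / r) *
      (radicalExp r' t * t ^ (b - 1) * (t * z⁻¹) ^ (a + k / r : ℝ))) (volume.restrict (Ioi 0)) :=
    integrable_finsetSum _ fun k _ => (hint _ (hak k)).const_mul _
  have hsum : ∑ k ∈ Finset.range r, z ^ (-(a + b) - k / r) *
        (radicalCoeff r k / (a + k / r) *
          ∏ l ∈ Finset.range r', Real.Gamma (a + b + k / r + l / r')) =
      z ^ (-b) * ∫ t in Ioi (0 : ℝ), ∑ k ∈ Finset.range r, radicalCoeff r k / (a + k / r) *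
      (radicalExp r' t * t ^ (b - 1) * (t * z⁻¹) ^ (a + k / r : ℝ)) := by
    rw [integral_finsetSum _ fun k _ => (hint _ (hak k)).const_mul _, Finset.mul_sum]
    refine Finset.sum_congr rfl fun k _ => ?_
    rw [integral_const_mul, hval _ (hak k),
      show -(a + b) - (k : ℝ) / r = -b + -(a + k / r) by ring, Real.rpow_add hz]
    simp only [show a + b + (k : ℝ) / r = a + k / r + b by ring]
    ring
  have hB : gaussConst r * r ^ r / (a + 1) * (∏ l ∈ Finset.range r', Real.Gamma (a + b + 1 + l / r')) *
        z ^ (-(a + b) - 1) = z ^ (-b) * ∫ t in Ioi (0 : ℝ), gaussConst r * r ^ r / (a + 1) *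
          (radicalExp r' t * t ^ (b - 1) * (t * z⁻¹) ^ (a + 1)) := by
    rw [integral_const_mul, hval _ (by linarith),
      show -(a + b) - 1 = -b + -(a + 1) by ring, Real.rpow_add hz]
    simp only [show a + b + 1 = a + 1 + b by ring]
    ring
  rw [hsum, hB, opticalConvolution_eq _ _ _ _ hz, ← mul_sub, ← integral_sub
    (integrableOn_radicalExp_mul_radicalPrimitive hr hr' ha hb z⁻¹) hsumi, abs_mul,
    abs_of_nonneg hzb]
  refine mul_le_mul_of_nonneg_left ?_ hzb
  rw [← Real.norm_eq_abs]
  refine norm_integral_le_of_norm_le ((hint _ (by linarith)).const_mul _) ?_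
  filter_upwards [ae_restrict_mem measurableSet_Ioi] with t ht
  have hpos : 0 < radicalExp r' t * t ^ (b - 1) :=
    mul_pos (mul_pos (gaussConst_pos (by omega)) (Real.exp_pos _)) (Real.rpow_pos_of_pos ht _)
  have h := mul_le_mul_of_nonneg_left
    (abs_radicalPrimitive_sub_sum_le hr ha (mul_pos ht (inv_pos.2 hz))) hpos.le
  calc _ = radicalExp r' t * t ^ (b - 1) * |radicalPrimitive r a (t * z⁻¹) -
        ∑ k ∈ Finset.range r, radicalCoeff r k / (a + k / r) * (t * z⁻¹) ^ (a + k / r : ℝ)| := by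
        rw [← abs_of_pos hpos, ← abs_mul, abs_of_pos hpos, mul_sub, Finset.mul_sum,
          Real.norm_eq_abs]
        congr 2
        exact Finset.sum_congr rfl fun k _ => by ring
    _ ≤ _ := h
    _ = _ := by ring

theorem list_prod_map_range {M : Type*} [CommMonoid M] (f : ℕ → M) (n : ℕ) :
    ((List.range n).map f).prod = ∏ k ∈ Finset.range n, f k := by
  induction n with
  | zero => simp
  | succ n ih => rw [List.range_succ, List.map_append, List.prod_append, ih,
      Finset.prod_range_succ]; simp

/-! ### Density and distribution function of an optical link -/

namespace OpticalLink

variable (X : OpticalLink)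

theorem r_pos : 0 < X.r := by
  have := X.r_eq
  omega

theorem meanY_pos : 0 < X.meanY := X.mean_pos

theorem w_pos : 0 < X.w := by
  have h : (0 : ℝ) < X.N := by exact_mod_cast X.N_pos
  exact div_pos (mul_pos h X.variance_pos) (mul_pos h X.mean_pos)

theorem ρ_pos : 0 < X.ρ := by
  have h : (0 : ℝ) < X.N := by exact_mod_cast X.N_pos
  exact div_pos (pow_pos (mul_pos h X.mean_pos) 2) (mul_pos h X.variance_pos)

/-- The shape of the received SNR. -/
def shape : ℝ := X.ρ / X.r

theorem shape_pos : 0 < X.shape := div_pos X.ρ_pos (by exact_mod_cast X.r_pos)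

theorem Υ₄_pos {τ : ℝ} (hτ : 0 < τ) : 0 < X.Υ₄ τ := by
  have h1 := X.meanY_pos
  have h2 := X.w_pos
  have h3 : (0 : ℝ) < X.r := by exact_mod_cast X.r_pos
  rw [Υ₄]
  positivity

theorem Υ₁_pos {τ : ℝ} (hτ : 0 < τ) : 0 < X.Υ₁ τ := by
  have h1 := X.meanY_pos
  have h2 := X.w_pos
  have h3 : (0 : ℝ) < X.r := by exact_mod_cast X.r_pos
  have h4 := Real.Gamma_pos_of_pos X.ρ_pos
  rw [Υ₁]
  positivity

theorem Υ₂_pos {τ : ℝ} (hτ : 0 < τ) : 0 < X.Υ₂ τ := by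
  have h1 := X.meanY_pos
  have h2 := X.w_pos
  rw [Υ₂]
  positivity

theorem Υ₃_eq (τ : ℝ) : X.Υ₃ τ = X.Υ₁ τ / gaussConst X.r := by
  have h3 : (0 : ℝ) < X.r := by exact_mod_cast X.r_pos
  have h4 : (X.r : ℝ) = √(X.r : ℝ) * √(X.r : ℝ) := (Real.mul_self_sqrt h3.le).symm
  have h5 : √(X.r : ℝ) ≠ 0 := (Real.sqrt_pos.2 h3).ne'
  rw [Υ₃, Υ₁, gaussConst]
  rw [div_div_div_eq, ← mul_div_mul_right _ _ h5]
  congr 1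
  linear_combination -(Real.Gamma X.ρ * X.w ^ X.ρ * τ ^ (X.ρ / X.r) *
    (2 * Real.pi) ^ (((X.r : ℝ) - 1) / 2)) * h4

theorem Υ₄_eq {τ : ℝ} (hτ : 0 < τ) : X.Υ₄ τ = X.Υ₂ τ ^ X.r * ((X.r : ℝ) ^ X.r)⁻¹ := by
  have h3 : (X.r : ℝ) ≠ 0 := by exact_mod_cast X.r_pos.ne'
  rw [Υ₄, Υ₂, div_pow, mul_pow, one_div, Real.rpow_inv_natCast_pow hτ.le X.r_pos.ne', ← div_eq_mul_inv,
    div_div]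
  ring_nf

/-- Since Υ₄ = (Υ₂/r)^r, the exponent Υ₂ γ^(1/r) is r (Υ₄ γ)^(1/r): up to a constant, the density is
a function of Υ₄ γ alone. -/
theorem pdf_eq {τ γ : ℝ} (hτ : 0 < τ) (hγ : 0 < γ) :
    X.pdf τ γ = X.Υ₁ τ / gaussConst X.r * X.Υ₄ τ ^ (1 - X.shape) *
      (radicalExp X.r (X.Υ₄ τ * γ) * (X.Υ₄ τ * γ) ^ (X.shape - 1)) := by
  have h3 : (0 : ℝ) < X.r := by exact_mod_cast X.r_pos
  have hη := X.Υ₄_pos hτ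
  have hΥ := X.Υ₂_pos hτ
  have hg := (gaussConst_pos X.r_pos).ne'
  have hroot : (X.r : ℝ) * (X.Υ₄ τ * γ) ^ (1 / (X.r : ℝ)) = X.Υ₂ τ * γ ^ (1 / (X.r : ℝ)) := by
    rw [Real.mul_rpow hη.le hγ.le, X.Υ₄_eq hτ, ← inv_pow, ← mul_pow, one_div,
      Real.pow_rpow_inv_natCast (by positivity) X.r_pos.ne']
    field_simp
  have hpow : X.Υ₄ τ ^ (1 - X.shape) * X.Υ₄ τ ^ (X.shape - 1) = 1 := by
    rw [← Real.rpow_add hη]; simp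
  rw [pdf, meijerG_exp (by positivity), radicalExp, hroot, Real.mul_rpow hη.le hγ.le]
  change X.Υ₁ τ * γ ^ (X.shape - 1) * _ = _
  have hC' : X.Υ₁ τ / gaussConst X.r * gaussConst X.r = X.Υ₁ τ := div_mul_cancel₀ _ hg
  linear_combination -(X.Υ₁ τ / gaussConst X.r * gaussConst X.r * γ ^ (X.shape - 1) *
    Real.exp (-(X.Υ₂ τ * γ ^ (1 / (X.r : ℝ))))) * hpow -
    γ ^ (X.shape - 1) * Real.exp (-(X.Υ₂ τ * γ ^ (1 / (X.r : ℝ)))) * hC'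

theorem cdf_eq {τ x : ℝ} (hτ : 0 < τ) (hx : 0 < x) :
    X.cdf τ x = X.Υ₁ τ / gaussConst X.r * X.Υ₄ τ ^ (-X.shape) *
      radicalPrimitive X.r X.shape (X.Υ₄ τ * x) := by
  have hη := X.Υ₄_pos hτ
  have h : ∀ u ∈ Ioc 0 x, X.pdf τ u = X.Υ₁ τ / gaussConst X.r * X.Υ₄ τ ^ (1 - X.shape) *
      (fun v => v ^ X.shape * radicalExp X.r v * v ^ ((0 : ℝ) - 1)) (X.Υ₄ τ * u) := by
    intro u hu
    have := mul_pos hη hu.1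
    simp only [zero_sub, Real.rpow_neg_one]
    rw [X.pdf_eq hτ hu.1, Real.rpow_sub_one this.ne']
    ring
  rw [cdf, intervalIntegral.integral_of_le hx.le, setIntegral_congr_fun measurableSet_Ioc h,
    integral_const_mul, ← intervalIntegral.integral_of_le hx.le,
    intervalIntegral.integral_comp_mul_left
      (fun v => v ^ X.shape * radicalExp X.r v * v ^ ((0 : ℝ) - 1)) hη.ne', mul_zero,
    intervalIntegral.integral_of_le (mul_pos hη hx).le, radicalPrimitive, weightedPrimitive,
    neg_zero, Real.rpow_zero, one_mul, smul_eq_mul, sub_eq_add_neg 1 X.shape,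
    Real.rpow_add hη, Real.rpow_one]
  field_simp

end OpticalLink

/-! ### The optical G-function: identification and expansion at infinity -/

theorem Υ₄'_pos (X : OpticalLink) {φ τ : ℝ} (hφ : 0 < φ) (hτ : 0 < τ) : 0 < Υ₄' X φ τ :=
  mul_pos hφ (X.Υ₄_pos hτ)

theorem Ω₁₈_eq (X E : OpticalLink) (φ : ℝ) {τE : ℝ} (hτE : 0 < τE) (τX : ℝ) :
    Ω₁₈ X E φ τE τX = E.Υ₄ τE / Υ₄' X φ τX := by
  rw [Ω₁₈, E.Υ₄_eq hτE]

theorem ζ_eq (X E : OpticalLink) : ζ X E = X.shape + E.shape := rfl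

theorem T₄_eq {X E : OpticalLink} {k : ℕ} (hk : k < X.r) :
    T₄ X E k = 1 - (X.shape + E.shape) - k / X.r := by
  rw [T₄, if_pos hk, ζ_eq]

theorem T₄_last (X E : OpticalLink) : T₄ X E X.r = 1 - E.shape := by
  rw [T₄, if_neg (lt_irrefl _)]; rfl

theorem T₅_eq {E : OpticalLink} {l : ℕ} (hl : l < E.r) : T₅ E l = l / E.r := by
  rw [T₅, if_pos hl]

theorem T₅_last (E : OpticalLink) : T₅ E E.r = -E.shape := by
  rw [T₅, if_neg (lt_irrefl _)]; rfl

/-- The last lower parameter and the last upper one differ by 1, so their Gamma quotient is 1/(s -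
b) with b = `E.shape`; the other factors are the transforms of the two radical exponentials. Only
the last lower and the first upper parameter bound the strip. -/
theorem opticalG_eq (X E : OpticalLink) {z : ℝ} (hz : 0 < z) :
    opticalG X E z = opticalConvolution X.r E.r X.shape E.shape z := by
  have ha := X.shape_pos
  have hb := E.shape_pos
  have hsep : ∀ σ : ℝ, SeparatesPoles ((List.range X.r).map (T₄ X E))
      ((List.range (E.r + 1)).map (T₅ E)) σ ↔ E.shape < σ ∧ σ < X.shape + E.shape := by
    intro σ
    simp only [SeparatesPoles, List.mem_map, List.mem_range, forall_exists_index, and_imp,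
      forall_apply_eq_imp_iff₂]
    constructor
    · rintro ⟨h1, h2⟩
      have h3 := h1 E.r (by omega)
      have h4 := h2 0 X.r_pos
      rw [T₅_last] at h3
      rw [T₄_eq X.r_pos] at h4
      norm_num at h3 h4
      exact ⟨h3, h4⟩
    · rintro ⟨h1, h2⟩
      constructor
      · intro l hl
        rcases Nat.lt_succ_iff_lt_or_eq.1 hl with hl | rfl
        · rw [T₅_eq hl]
          have : (0 : ℝ) ≤ l / E.r := by positivity
          linarith
        · rw [T₅_last]
          linarith
      · intro k hk
        rw [T₄_eq hk]
        have : (0 : ℝ) ≤ k / X.r := by positivity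
        linarith
  have hker : ∀ s : ℂ, E.shape < s.re → meijerKernel ((List.range X.r).map (T₄ X E))
      [T₄ X E X.r] ((List.range (E.r + 1)).map (T₅ E)) [] s =
      (∏ l ∈ Finset.range E.r, Complex.Gamma (s + ((l / E.r : ℝ) : ℂ))) *
      ((∏ l ∈ Finset.range X.r, Complex.Gamma (-(s - E.shape) + X.shape + ((l / X.r : ℝ) : ℂ))) /
        (s - E.shape)) := by
    intro s hs
    have h1 := Gamma_div_Gamma_one_add (s := s - E.shape) (by simpa using hs)
    have h2 : ∏ l ∈ Finset.range E.r, Complex.Gamma ((T₅ E l : ℂ) + s) =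
        ∏ l ∈ Finset.range E.r, Complex.Gamma (s + ((l / E.r : ℝ) : ℂ)) :=
      Finset.prod_congr rfl fun l hl => by rw [T₅_eq (Finset.mem_range.1 hl), add_comm]
    have h3 : ∏ k ∈ Finset.range X.r, Complex.Gamma (1 - (T₄ X E k : ℂ) - s) =
        ∏ l ∈ Finset.range X.r,
          Complex.Gamma (-(s - E.shape) + X.shape + ((l / X.r : ℝ) : ℂ)) :=
      Finset.prod_congr rfl fun l hl => by
        rw [T₄_eq (Finset.mem_range.1 hl)]
        congr 1
        push_cast
        ring
    simp only [meijerKernel, List.map_map, list_prod_map_range, Function.comp_def,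
      Finset.prod_range_succ, h2, h3, T₄_last, T₅_last, List.map_cons, List.map_nil,
      List.prod_cons, List.prod_nil, mul_one, one_mul]
    push_cast
    rw [show -(E.shape : ℂ) + s = s - E.shape by ring,
      show (1 : ℂ) - E.shape + s = 1 + (s - E.shape) by ring, mul_right_comm, mul_div_assoc, h1]
    ring
  obtain ⟨σ₀, hσ₀⟩ := exists_between (show E.shape < X.shape + E.shape by linarith)
  refine meijerG_eq ⟨σ₀, (hsep _).2 hσ₀⟩ (fun s hs => ?_) (fun σ hσ => ?_) hz
    (continuousAt_opticalConvolution X.r_eq E.r_eq ha hb hz)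
  · have hs := (hsep _).1 hs
    rw [hker s hs.1]
    exact hasMellin_opticalConvolution X.r_eq E.r_eq hb hs.1 hs.2
  · have hσ := (hsep _).1 hσ
    have e := fun y : ℝ => hker (σ + y * Complex.I) (by simpa using hσ.1)
    simp only [e]
    refine QuadraticDecay.mul (QuadraticDecay.prod_range E.r_pos.ne' fun l =>
      quadraticDecay_Gamma (x := σ + l / E.r) ?_ (by fun_prop) (fun y => ?_) (by simp))
      (QuadraticDecay.div_of_re (x := σ - E.shape) (QuadraticDecay.prod_range X.r_pos.ne' fun l =>
      quadraticDecay_Gamma (x := -(σ - E.shape) + X.shape + l / X.r) ?_ (by fun_prop)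
        (fun y => ?_) (by simp)) (by linarith) (by fun_prop) (by simp))
    · have : (0 : ℝ) ≤ l / E.r := by positivity
      linarith
    · simp only [Complex.add_re, Complex.ofReal_re]; simp
    · have : (0 : ℝ) ≤ l / X.r := by positivity
      linarith
    · simp only [Complex.add_re, Complex.neg_re, Complex.sub_re, Complex.ofReal_re]; simp

/-- Matches Taylor coefficients with residues: for r = 2 they are Γ(1/2) = √π and Γ(-1/2) = -2√π. -/
theorem radicalCoeff_eq_prod {r k : ℕ} (hr : r = 1 ∨ r = 2) (hk : k < r) :
    radicalCoeff r k = ∏ l ∈ (Finset.range r).erase k, Real.Gamma ((l : ℝ) / r - k / r) := by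
  rcases hr with rfl | rfl
  · obtain rfl : k = 0 := by omega
    simp [radicalCoeff, gaussConst_one]
  · have h1 : (Finset.range 2).erase 0 = {1} := by decide
    have h2 : (Finset.range 2).erase 1 = {0} := by decide
    interval_cases k
    · rw [h1, Finset.prod_singleton, radicalCoeff, gaussConst_two]
      norm_num
      rw [Real.Gamma_one_half_eq]
    · have h : Real.Gamma (1 / 2) = (-(1 / 2)) * Real.Gamma (-(1 / 2)) := by
        rw [← Real.Gamma_add_one (by norm_num)]
        norm_num
      rw [Real.Gamma_one_half_eq] at h
      rw [h2, Finset.prod_singleton, radicalCoeff, gaussConst_two]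
      norm_num at h ⊢
      linarith

/-- With x = `X.shape` + k/r, the last Gamma factor over the denominator is Γ(x)/Γ(x + 1) = 1/x, the
factor produced by integrating a power. -/
theorem opticalResidueSum_eq (X E : OpticalLink) (z : ℝ) :
    opticalResidueSum X E z = ∑ k ∈ Finset.range X.r, z ^ (-(X.shape + E.shape) - k / X.r) *
        (radicalCoeff X.r k / (X.shape + k / X.r) *
          ∏ l ∈ Finset.range E.r, Real.Gamma (X.shape + E.shape + k / X.r + l / E.r)) := by
  refine Finset.sum_congr rfl fun k hk => ?_
  have hk := Finset.mem_range.1 hk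
  have ha : 0 < X.shape + (k : ℝ) / X.r := by
    have := X.shape_pos
    positivity
  have h1 : ∏ l ∈ (Finset.range X.r).erase k, Real.Gamma (T₄ X E k - T₄ X E l) =
      radicalCoeff X.r k := by
    rw [radicalCoeff_eq_prod X.r_eq hk]
    refine Finset.prod_congr rfl fun l hl => ?_
    rw [T₄_eq hk, T₄_eq (Finset.mem_range.1 (Finset.mem_of_mem_erase hl))]
    congr 1
    ring
  have h2 : ∏ l ∈ Finset.range E.r, Real.Gamma (1 + T₅ E l - T₄ X E k) =
      ∏ l ∈ Finset.range E.r, Real.Gamma (X.shape + E.shape + k / X.r + l / E.r) := by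
    refine Finset.prod_congr rfl fun l hl => ?_
    rw [T₄_eq hk, T₅_eq (Finset.mem_range.1 hl)]
    congr 1
    ring
  have h3 := (Real.Gamma_pos_of_pos ha).ne'
  rw [h1, Finset.prod_range_succ, h2, T₅_last, T₄_last, T₄_eq hk,
    show 1 - (X.shape + E.shape) - (k : ℝ) / X.r - 1 = -(X.shape + E.shape) - k / X.r by ring,
    show 1 + -E.shape - (1 - (X.shape + E.shape) - (k : ℝ) / X.r) = X.shape + k / X.r by ring,
    show 1 + (1 - E.shape) - (1 - (X.shape + E.shape) - (k : ℝ) / X.r) =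
      X.shape + k / X.r + 1 by ring, Real.Gamma_add_one ha.ne']
  field_simp

theorem isLittleO_rpow_rpow_atTop {a b : ℝ} (h : a < b) :
    (fun z : ℝ => z ^ a) =o[atTop] fun z : ℝ => z ^ b := by
  refine (isLittleO_iff_tendsto' ?_).2 ?_
  · filter_upwards [eventually_gt_atTop 0] with z hz h0
    exact absurd h0 (Real.rpow_pos_of_pos hz b).ne'
  · refine (tendsto_rpow_neg_atTop (sub_pos.2 h)).congr' ?_
    filter_upwards [eventually_gt_atTop 0] with z hz
    rw [← Real.rpow_sub hz, neg_sub]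

/-- The error is O(z^(-ζ-1)), while the terms of the sum have exponents -ζ - k/r with k/r < 1. -/
theorem opticalG_sub_residueSum_isLittleO (X E : OpticalLink) {k : ℕ} (hk : k < X.r) :
    (fun z : ℝ => opticalG X E z - opticalResidueSum X E z)
      =o[atTop] fun z : ℝ => z ^ (T₄ X E k - 1) := by
  have hr : (0 : ℝ) < X.r := by exact_mod_cast X.r_pos
  have hk' : (k : ℝ) / X.r < 1 := (div_lt_one hr).2 (by exact_mod_cast hk)
  refine IsBigO.trans_isLittleO (g := fun z : ℝ => z ^ (-(X.shape + E.shape) - 1)) ?_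
    (isLittleO_rpow_rpow_atTop (by rw [T₄_eq hk]; linarith))
  refine IsBigO.of_bound (gaussConst X.r * X.r ^ X.r / (X.shape + 1) *
    ∏ l ∈ Finset.range E.r, Real.Gamma (X.shape + E.shape + 1 + l / E.r)) ?_
  filter_upwards [eventually_gt_atTop 0] with z hz
  rw [opticalG_eq X E hz, opticalResidueSum_eq, Real.norm_eq_abs,
    Real.norm_of_nonneg (Real.rpow_nonneg hz.le _)]
  exact abs_opticalConvolution_sub_sum_le X.r_eq E.r_eq X.shape_pos E.shape_pos hz

/-- The term k = 0 dominates and has a positive coefficient; for r = 2 the other coefficient is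
negative, so the sign of the sum is known only for large z. -/
theorem opticalResidueSum_isEquivalent (X E : OpticalLink) :
    ∃ C : ℝ, 0 < C ∧
      opticalResidueSum X E ~[atTop] fun z => C * z ^ (-(X.shape + E.shape)) := by
  have ha := X.shape_pos
  have hb := E.shape_pos
  have hr : (0 : ℝ) < X.r := by exact_mod_cast X.r_pos
  set D : ℕ → ℝ := fun k => radicalCoeff X.r k / (X.shape + k / X.r) *
          ∏ l ∈ Finset.range E.r, Real.Gamma (X.shape + E.shape + k / X.r + l / E.r) with hD
  have hD0 : 0 < D 0 := by
    have h1 : 0 < radicalCoeff X.r 0 := by simpa [radicalCoeff] using gaussConst_pos X.r_pos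
    have h2 : 0 < ∏ l ∈ Finset.range E.r,
        Real.Gamma (X.shape + E.shape + (0 : ℕ) / X.r + l / E.r) :=
      Finset.prod_pos fun l _ => Real.Gamma_pos_of_pos (by positivity)
    have h3 : 0 < X.shape + ((0 : ℕ) : ℝ) / X.r := by positivity
    exact mul_pos (div_pos h1 h3) h2
  refine ⟨D 0, hD0, ?_⟩
  have h0 : 0 ∈ Finset.range X.r := Finset.mem_range.2 X.r_pos
  have e : ∀ z, opticalResidueSum X E z - D 0 * z ^ (-(X.shape + E.shape)) =
      ∑ k ∈ (Finset.range X.r).erase 0, z ^ (-(X.shape + E.shape) - k / X.r) * D k := by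
    intro z
    rw [opticalResidueSum_eq, ← Finset.add_sum_erase _ _ h0]
    simp only [Nat.cast_zero, zero_div, sub_zero, hD]
    ring
  rw [IsEquivalent, isLittleO_const_mul_right_iff hD0.ne']
  refine IsLittleO.congr_left (IsLittleO.fun_sum fun k hk => ?_) fun z => (e z).symm
  have hk0 : (0 : ℝ) < k := by
    exact_mod_cast Nat.pos_of_ne_zero (Finset.ne_of_mem_erase hk)
  simp only [mul_comm _ (D k)]
  refine IsLittleO.const_mul_left (isLittleO_rpow_rpow_atTop ?_) _
  have : 0 < (k : ℝ) / X.r := by positivity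
  linarith

theorem opticalG_isEquivalent (X E : OpticalLink) :
    opticalG X E ~[atTop] opticalResidueSum X E := by
  obtain ⟨C, hC, h⟩ := opticalResidueSum_isEquivalent X E
  have h1 := opticalG_sub_residueSum_isLittleO X E X.r_pos
  have e : T₄ X E 0 - 1 = -(X.shape + E.shape) := by
    rw [T₄_eq X.r_pos]; norm_num
  rw [e, ← isLittleO_const_mul_right_iff hC.ne'] at h1
  exact h1.trans_isBigO h.symm.isBigO

theorem eventually_opticalResidueSum_pos (X E : OpticalLink) :
    ∀ᶠ z in atTop, 0 < opticalResidueSum X E z := by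
  obtain ⟨C, hC, h⟩ := opticalResidueSum_isEquivalent X E
  refine h.eventually_pos ?_
  filter_upwards [eventually_gt_atTop 0] with z hz
  exact mul_pos hC (Real.rpow_pos_of_pos hz _)

/-! ### The outage integral in closed form -/

/-- The probability that the eavesdropper has the stronger link, up to the factor `φ`. -/
theorem integral_cdf_mul_pdf (X E : OpticalLink) {φ τE τX : ℝ} (hφ : 0 < φ) (hτE : 0 < τE)
    (hτX : 0 < τX) :
    ∫ γ in Ioi (0 : ℝ), X.cdf τX (φ * γ) * E.pdf τE γ =
      opticalFactor X E φ τE τX * opticalG X E (Ω₁₈ X E φ τE τX) := by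
  have hX := X.Υ₄_pos hτX
  have hE := E.Υ₄_pos hτE
  have hX' := Υ₄'_pos X hφ hτX
  have hΩ : 0 < Ω₁₈ X E φ τE τX := by rw [Ω₁₈_eq X E φ hτE]; positivity
  have h1 : ∀ γ ∈ Ioi (0 : ℝ), X.cdf τX (φ * γ) * E.pdf τE γ =
      (X.Υ₁ τX / gaussConst X.r * X.Υ₄ τX ^ (-X.shape)) *
        (E.Υ₁ τE / gaussConst E.r * E.Υ₄ τE ^ (1 - E.shape)) *
      (fun t => radicalExp E.r t * t ^ (E.shape - 1) *
        radicalPrimitive X.r X.shape (t * (Ω₁₈ X E φ τE τX)⁻¹)) (E.Υ₄ τE * γ) := by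
    intro γ hγ
    have hγ : 0 < γ := hγ
    have e : E.Υ₄ τE * γ * (Ω₁₈ X E φ τE τX)⁻¹ = X.Υ₄ τX * (φ * γ) := by
      rw [Ω₁₈_eq X E φ hτE, Υ₄']
      field_simp
    simp only [e]
    rw [X.cdf_eq hτX (mul_pos hφ hγ), E.pdf_eq hτE hγ]
    ring
  have h2 := integral_comp_mul_left_Ioi (fun t => radicalExp E.r t * t ^ (E.shape - 1) *
        radicalPrimitive X.r X.shape (t * (Ω₁₈ X E φ τE τX)⁻¹)) 0 hE
  rw [mul_zero, smul_eq_mul] at h2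
  have h3 : E.Υ₄ τE ^ (1 - E.shape) * (E.Υ₄ τE)⁻¹ = E.Υ₄ τE ^ (-E.shape) := by
    rw [← Real.rpow_neg_one, ← Real.rpow_add hE]
    ring_nf
  -- Constants are matched by splitting Υ₄'^(-ζ) into a share per link. The share of E joins the
  -- power of Ω₁₈ coming from the convolution, and that of X absorbs the power of φ in Υ₃'.
  have h4 : Ω₁₈ X E φ τE τX ^ (-E.shape) * Υ₄' X φ τX ^ (-E.shape) = E.Υ₄ τE ^ (-E.shape) := by
    rw [← Real.mul_rpow hΩ.le hX'.le, Ω₁₈_eq X E φ hτE, div_mul_cancel₀ _ hX'.ne']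
  have h5 : φ ^ X.shape * Υ₄' X φ τX ^ (-X.shape) = X.Υ₄ τX ^ (-X.shape) := by
    rw [Υ₄', Real.mul_rpow hφ.le hX.le, ← mul_assoc, ← Real.rpow_add hφ]
    simp
  have h6 : Υ₄' X φ τX ^ (-ζ X E) = Υ₄' X φ τX ^ (-X.shape) * Υ₄' X φ τX ^ (-E.shape) := by
    rw [ζ_eq, ← Real.rpow_add hX']
    ring_nf
  have h7 : opticalFactor X E φ τE τX = X.Υ₁ τX / gaussConst X.r * (E.Υ₁ τE / gaussConst E.r) *
      X.Υ₄ τX ^ (-X.shape) * Υ₄' X φ τX ^ (-E.shape) := by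
    rw [opticalFactor, h6, Υ₃', X.Υ₃_eq, ← h5, gaussConst.eq_1 E.r]
    change φ ^ X.shape * _ * _ * _ / _ = _
    rw [div_div_eq_mul_div]
    ring
  rw [setIntegral_congr_fun measurableSet_Ioi h1, integral_const_mul, h2, opticalG_eq X E hΩ,
    opticalConvolution_eq _ _ _ _ hΩ, h7]
  set I := ∫ t in Ioi (0 : ℝ), radicalExp E.r t * t ^ (E.shape - 1) *
        radicalPrimitive X.r X.shape (t * (Ω₁₈ X E φ τE τX)⁻¹)
  linear_combination (X.Υ₁ τX / gaussConst X.r * X.Υ₄ τX ^ (-X.shape) *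
    (E.Υ₁ τE / gaussConst E.r) * I) * (h3 - h4)

theorem sopL_eq_sopMeijer (R : RFLink) (X E : OpticalLink) (p : ℕ) {φ τE snr τX : ℝ} (hφ : 1 < φ)
    (hτE : 0 < τE) (hsnr : 0 < snr) (hτX : 0 < τX) :
    sopL R X E p φ τE snr τX = sopMeijer R X E p φ τE snr τX := by
  rw [sopL, sopMeijer, integral_cdf_mul_pdf X E (by linarith) hτE hτX,
    R.cdf_eq p hsnr (sub_pos.2 hφ), Ω₂₀]

/-! ### High signal-to-noise ratio -/

/-- Asymptotic equivalence is not additive in general; nonnegativity excludes cancellation, since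
then |v| + |w| = v + w. -/
theorem isEquivalent_add_of_eventually_nonneg {α : Type*} {u v t w : α → ℝ} {l : Filter α}
    (hv : ∀ᶠ x in l, 0 ≤ v x) (hw : ∀ᶠ x in l, 0 ≤ w x) (huv : u ~[l] v) (htw : t ~[l] w) :
    (fun x => u x + t x) ~[l] fun x => v x + w x := by
  refine (IsLittleO.add_add huv htw).congr' (Eventually.of_forall fun x => ?_) ?_
  · simp only [Pi.sub_apply]
    ring
  · filter_upwards [hv, hw] with x h1 h2
    rw [Real.norm_of_nonneg h1, Real.norm_of_nonneg h2]

namespace RFLink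

variable (R : RFLink)

/-- Equivalence of the individual terms would not suffice, as their coefficients have mixed signs.
All three claims rest on the positive total coefficient of the lowest power z^(c 0), against which
every error is negligible. -/
theorem sum_G_isEquivalent (p : ℕ) (hp : 1 ≤ p) :
    ((fun z => ∑ i : Fin 3, ∑ k ∈ Finset.range (p + 1), R.K₁ p i k * R.G i k z) ~[𝓝[>] 0]
      fun z => ∑ i : Fin 3, ∑ k ∈ Finset.range (p + 1), R.K₁ p i k * R.residue i k z) ∧
    (∀ᶠ z in 𝓝[>] 0,
      0 < ∑ i : Fin 3, ∑ k ∈ Finset.range (p + 1), R.K₁ p i k * R.residue i k z) ∧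
    Tendsto (fun z => ∑ i : Fin 3, ∑ k ∈ Finset.range (p + 1), R.K₁ p i k * R.residue i k z)
      (𝓝[>] 0) (𝓝 0) := by
  set C := ∑ i : Fin 3, R.K₁ p i 0 * (1 / (R.c 0 + R.Ψ i) / R.c 0) with hC
  have hC0 : 0 < C := R.leadingCoefficient_pos p hp
  have hcle : ∀ k, R.c 0 ≤ R.c k := fun k => by simp [c]
  have hlead : (fun z => ∑ i : Fin 3, ∑ k ∈ Finset.range (p + 1), R.K₁ p i k * R.residue i k z)
      ~[𝓝[>] 0] fun z => C * z ^ R.c 0 := by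
    have e : ∀ z, (∑ i : Fin 3, ∑ k ∈ Finset.range (p + 1), R.K₁ p i k * R.residue i k z) -
        C * z ^ R.c 0 = ∑ i : Fin 3, ∑ k ∈ Finset.range p,
          R.K₁ p i (k + 1) * (1 / (R.c (k + 1) + R.Ψ i) / R.c (k + 1)) * z ^ R.c (k + 1) := by
      intro z
      rw [hC, Finset.sum_mul, ← Finset.sum_sub_distrib]
      refine Finset.sum_congr rfl fun i _ => ?_
      rw [Finset.sum_range_succ']
      simp only [R.residue_eq]
      simp only [mul_assoc, add_sub_cancel_right]
    rw [IsEquivalent, isLittleO_const_mul_right_iff hC0.ne']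
    refine IsLittleO.congr_left (IsLittleO.fun_sum fun i _ => IsLittleO.fun_sum fun k _ =>
      IsLittleO.const_mul_left (isLittleO_rpow_rpow_nhdsGT ?_) _) fun z => (e z).symm
    simp [c]
    positivity
  refine ⟨?_, ?_, ?_⟩
  · have h1 : (fun z => (∑ i : Fin 3, ∑ k ∈ Finset.range (p + 1), R.K₁ p i k * R.G i k z) -
        ∑ i : Fin 3, ∑ k ∈ Finset.range (p + 1), R.K₁ p i k * R.residue i k z) =o[𝓝[>] 0]
          fun z => z ^ R.c 0 := by
      simp only [← Finset.sum_sub_distrib, ← mul_sub]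
      refine IsLittleO.fun_sum fun i _ => IsLittleO.fun_sum fun k _ => IsLittleO.const_mul_left
        ((R.G_sub_residue_isBigO i k).trans_isLittleO (isLittleO_rpow_rpow_nhdsGT ?_)) _
      linarith [hcle k]
    rw [← isLittleO_const_mul_right_iff hC0.ne'] at h1
    exact h1.trans_isBigO hlead.symm.isBigO
  · refine hlead.eventually_pos ?_
    filter_upwards [self_mem_nhdsWithin] with z hz
    exact mul_pos hC0 (Real.rpow_pos_of_pos hz _)
  · refine hlead.symm.tendsto_nhds ?_
    have := ((Real.continuousAt_rpow_const 0 (R.c 0) (Or.inr (R.c_pos 0).le)).tendsto).const_mul C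
    rw [Real.zero_rpow (R.c_pos 0).ne', mul_zero] at this
    exact this.mono_left nhdsWithin_le_nhds

theorem tendsto_Ω₂₀ {φ : ℝ} (hφ : 1 < φ) : Tendsto (Ω₂₀ R φ) atTop (𝓝[>] 0) := by
  refine tendsto_nhdsWithin_iff.2 ⟨?_, ?_⟩
  · have e : Ω₂₀ R φ = fun snr => R.B * R.D ^ R.α / (R.ϱ * R.L) * (φ - 1) * snr⁻¹ := by
      funext snr
      rw [Ω₂₀, K₂, ← div_div]
      ring
    rw [e]
    simpa using tendsto_inv_atTop_zero.const_mul (R.B * R.D ^ R.α / (R.ϱ * R.L) * (φ - 1))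
  · filter_upwards [eventually_gt_atTop 0] with snr h
    exact mul_pos (R.K₂_pos h) (sub_pos.2 hφ)

end RFLink

theorem tendsto_Ω₁₈ (X E : OpticalLink) {φ τE : ℝ} (hφ : 0 < φ) (hτE : 0 < τE) :
    Tendsto (Ω₁₈ X E φ τE) atTop atTop := by
  have h1 := X.meanY_pos
  have h2 := X.w_pos
  have h3 : (0 : ℝ) < X.r := by exact_mod_cast X.r_pos
  have h4 := E.Υ₄_pos hτE
  have e : Ω₁₈ X E φ τE = fun τX =>
      E.Υ₄ τE * ((X.r : ℝ) ^ X.r * X.w ^ X.r) / (φ * X.meanY ^ X.r) * τX := by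
    funext τX
    rw [Ω₁₈_eq X E φ hτE, Υ₄', OpticalLink.Υ₄.eq_1 X]
    field_simp
  rw [e]
  exact tendsto_id.const_mul_atTop (by positivity)

theorem opticalFactor_pos (X E : OpticalLink) {φ τE τX : ℝ} (hφ : 0 < φ) (hτE : 0 < τE)
    (hτX : 0 < τX) : 0 < opticalFactor X E φ τE τX := by
  have h1 := X.Υ₁_pos hτX
  have h2 := E.Υ₁_pos hτE
  have h3 := Υ₄'_pos X hφ hτX
  have h4 : (0 : ℝ) < E.r := by exact_mod_cast E.r_pos
  have h5 := gaussConst_pos X.r_pos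
  have h6 := Real.pi_pos
  rw [opticalFactor, Υ₃', X.Υ₃_eq]
  positivity

/-- The radio quantities depend on the first variable only and the optical ones on the second, so
each one-variable equivalence pulls back along a projection of the product filter and no relation
between the rates enters. -/
theorem sopL_isEquivalent (R : RFLink) (X E : OpticalLink) (p : ℕ) (hp : 1 ≤ p) {φ τE : ℝ}
    (hφ : 1 < φ) (hτE : 0 < τE) :
    (fun x : ℝ × ℝ => sopL R X E p φ τE x.1 x.2) ~[atTop ×ˢ atTop]
      (fun x : ℝ × ℝ => sopAsymptotic R X E p φ τE x.1 x.2) := by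
  have hφ0 : 0 < φ := by linarith
  obtain ⟨hF, hFpos, hF0⟩ := R.sum_G_isEquivalent p hp
  have hΩR := (R.tendsto_Ω₂₀ hφ).comp (tendsto_fst (f := atTop) (g := (atTop : Filter ℝ)))
  have hΩX := (tendsto_Ω₁₈ X E hφ0 hτE).comp (tendsto_snd (f := (atTop : Filter ℝ)) (g := atTop))
  have h1 := hF.comp_tendsto hΩR
  have h2 := (opticalG_isEquivalent X E).comp_tendsto hΩX
  have h3 := hF0.comp hΩR
  have h4 := hF.symm.tendsto_nhds hF0 |>.comp hΩR
  have h5 : Tendsto (fun x : ℝ × ℝ => (1 : ℝ) - ((fun z => ∑ i : Fin 3,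
      ∑ k ∈ Finset.range (p + 1), R.K₁ p i k * R.residue i k z) ∘ Ω₂₀ R φ ∘ Prod.fst) x)
      (atTop ×ˢ atTop) (𝓝 1) := by simpa using h3.const_sub 1
  have h6 : Tendsto (fun x : ℝ × ℝ => (1 : ℝ) - ((fun z => ∑ i : Fin 3,
      ∑ k ∈ Finset.range (p + 1), R.K₁ p i k * R.G i k z) ∘ Ω₂₀ R φ ∘ Prod.fst) x)
      (atTop ×ˢ atTop) (𝓝 1) := by simpa using h4.const_sub 1
  -- Both complementary factors tend to 1, hence are equivalent to each other through that constant.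
  have h7 := ((isEquivalent_const_iff_tendsto one_ne_zero).2 h6).trans
    ((isEquivalent_const_iff_tendsto one_ne_zero).2 h5).symm
  have h8 := (((IsEquivalent.refl (u := fun x : ℝ × ℝ => opticalFactor X E φ τE x.2)
    (l := atTop ×ˢ atTop)).mul h2).mul h7)
  have hsnr : ∀ᶠ x : ℝ × ℝ in atTop ×ˢ atTop, 0 < x.1 :=
    tendsto_fst.eventually (eventually_gt_atTop 0)
  have hτX : ∀ᶠ x : ℝ × ℝ in atTop ×ˢ atTop, 0 < x.2 :=
    tendsto_snd.eventually (eventually_gt_atTop 0)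
  have h9 : (fun x : ℝ × ℝ => sopL R X E p φ τE x.1 x.2) =ᶠ[atTop ×ˢ atTop]
      fun x => sopMeijer R X E p φ τE x.1 x.2 := by
    filter_upwards [hsnr, hτX] with x hx1 hx2
    exact sopL_eq_sopMeijer R X E p hφ hτE hx1 hx2
  have h10 : ∀ᶠ x : ℝ × ℝ in atTop ×ˢ atTop, 0 ≤ opticalFactor X E φ τE x.2 *
      opticalResidueSum X E (Ω₁₈ X E φ τE x.2) * (1 - ∑ i : Fin 3,
        ∑ k ∈ Finset.range (p + 1), R.K₁ p i k * R.residue i k (Ω₂₀ R φ x.1)) := by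
    filter_upwards [hτX, hΩX.eventually (eventually_opticalResidueSum_pos X E),
      h5.eventually (eventually_gt_nhds one_pos)] with x hx1 hx2 hx3
    exact (mul_pos (mul_pos (opticalFactor_pos X E hφ0 hτE hx1) hx2) hx3).le
  have h11 : ∀ᶠ x : ℝ × ℝ in atTop ×ˢ atTop, 0 ≤ ∑ i : Fin 3,
      ∑ k ∈ Finset.range (p + 1), R.K₁ p i k * R.residue i k (Ω₂₀ R φ x.1) := by
    filter_upwards [hΩR.eventually hFpos] with x hx
    exact hx.le
  exact (isEquivalent_add_of_eventually_nonneg h10 h11 h8 h1).congr_left h9.symm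

end Secrecy

end

theorem mainTheorem9 (R : Secrecy.RFLink) (X E : Secrecy.OpticalLink) (p : ℕ) (hp : 1 ≤ p)
    (Rs φ τE : ℝ) (hRs : 0 < Rs) (hφ : φ = 2 ^ Rs) (hτE : 0 < τE) :
    -- the lower bound is given by Meijer G-functions
    (∀ snr τX : ℝ, 0 < snr → 0 < τX →
      Secrecy.sopL R X E p φ τE snr τX = Secrecy.sopMeijer R X E p φ τE snr τX) ∧
    -- each of which is replaced by its residues, in the optical case up to an error of smaller
    -- order than every term of the residue sum
    (∀ k < X.r, (fun z : ℝ => Secrecy.opticalG X E z - Secrecy.opticalResidueSum X E z)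
      =o[atTop] fun z : ℝ => z ^ (Secrecy.T₄ X E k - 1)) ∧
    (∀ (i : Fin 3) (k : ℕ), R.G i k ~[𝓝[>] 0] R.residue i k) ∧
    -- and this gives the lower bound at high SNR
    (fun x : ℝ × ℝ => Secrecy.sopL R X E p φ τE x.1 x.2) ~[atTop ×ˢ atTop]
      (fun x : ℝ × ℝ => Secrecy.sopAsymptotic R X E p φ τE x.1 x.2) := by
  have hφ1 : 1 < φ := hφ ▸ Real.one_lt_rpow one_lt_two hRs
  exact ⟨fun snr τX hsnr hτX => Secrecy.sopL_eq_sopMeijer R X E p hφ1 hτE hsnr hτX,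
    fun k hk => Secrecy.opticalG_sub_residueSum_isLittleO X E hk,
    fun i k => R.G_isEquivalent_residue i k, Secrecy.sopL_isEquivalent R X E p hp hφ1 hτE⟩
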